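/- Let $\alpha>0$, $0<\rho\le 1$ and $0<\varepsilon<\alpha/3$. Let $(c_k)_{k\ge 1}$ be a sequence of non-negative reals for which there are constants $0<A_1<A_2$ such that, for all sufficiently large $n$, $$A_1\, n^{2\alpha/3+\varepsilon-1}\rho^{-n}\le c_n\le A_2\, n^{\alpha-1}\rho^{-n}$$ (that is, $(c_k)\in\mathcal F(2\alpha/3+\varepsilon,\alpha,\rho)$). For $|x|<\rho$ put $$C(x)=\sum_{k\ge1}c_kx^k,\qquad S(x)=e^{C(x)},\qquad G(x)=\exp\Big(\sum_{j\ge1}C(x^j)/j\Big).$$ Then, for every $\ell\in\mathbb N_0$ and $(p_1,\dots,p_\ell)\in\mathbb N_0^\ell$, the functions $$S(x)\,C(x)^\ell\qquad\text{and}\qquad G(x)\prod_{1\le i\le\ell}\ \sum_{j\ge1}j^{p_i}C(x^j)$$ are $H$-admissible with radius of convergence $\rho$. Moreover, for every $\delta$ with $\alpha/3<\delta<\alpha/3+\varepsilon/2$, both are $H$-admissible with $\theta_0(r)=\chi^{1+\delta}$, where $r=\rho e^{-\chi}$, i.e. $\chi=\ln(\rho/r)$. Here a function $F$ given by a power series about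 $0$ with radius of convergence $\rho\in(0,\infty)$ is called $H$-admissible with $\theta_0$ if, on some interval $(R_0,\rho)\subseteq(0,\rho)$, $F$ is real and positive and $\theta_0$ is positive, and, with $f=\ln F$, $a(r)=rf'(r)$ and $b(r)=r^2f''(r)+rf'(r)$, the following hold. 1. (Capture) $a(r)\to\infty$ and $b(r)\to\infty$ as $r\to\rho^-$. 2. (Locality) $F(re^{i\theta})\sim F(r)\exp\big(i\theta a(r)-\tfrac{\theta^2}{2}b(r)\big)$ as $r\to\rho^-$, uniformly in $|\theta|\le\theta_0(r)$. 3. (Decay) $F(re^{i\theta})=o\big(b(r)^{-1/2}F(r)\big)$ as $r\to\rho^-$, uniformly in $\theta_0(r)\le|\theta|<\pi$. $F$ is called $H$-admissible if this holds for some function $\theta_0$. -/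

import Mathlib

open Filter Topology

noncomputable section

/-- The class of oscillating expansive sequences with parameters `α₁, α₂, ρ`. Sequences are indexed
by the positive integers; the value `c 0` plays no role anywhere. -/
def oscillatingExpansive (α₁ α₂ ρ : ℝ) : Set (ℕ → ℝ) :=
  {c | (∀ k : ℕ, 1 ≤ k → 0 ≤ c k) ∧
    ∃ A₁ A₂ : ℝ, 0 < A₁ ∧ A₁ < A₂ ∧ ∀ᶠ n : ℕ in atTop,
      A₁ * (n : ℝ) ^ (α₁ - 1) * ρ ^ (-(n : ℤ)) ≤ c n ∧
      c n ≤ A₂ * (n : ℝ) ^ (α₂ - 1) * ρ ^ (-(n : ℤ))}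

/-- `C(x) = ∑_{k ≥ 1} c_k x^k`. -/
def clusterSeries (c : ℕ → ℝ) (x : ℂ) : ℂ :=
  ∑' k : ℕ, (c (k + 1) : ℂ) * x ^ (k + 1)

/-- `S(x) = exp (C(x))`. -/
def setSeries (c : ℕ → ℝ) (x : ℂ) : ℂ :=
  Complex.exp (clusterSeries c x)

/-- `G(x) = exp (∑_{j ≥ 1} C(x^j) / j)`. -/
def multisetSeries (c : ℕ → ℝ) (x : ℂ) : ℂ :=
  Complex.exp (∑' j : ℕ, clusterSeries c (x ^ (j + 1)) / ((j + 1 : ℕ) : ℂ))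

/-- `∑_{j ≥ 1} j^p C(x^j)`. -/
def weightedClusterSeries (c : ℕ → ℝ) (p : ℕ) (x : ℂ) : ℂ :=
  ∑' j : ℕ, ((j + 1 : ℕ) : ℂ) ^ p * clusterSeries c (x ^ (j + 1))

/-- `f = ln F` along the real axis, where `F` is real and positive close to its radius of
convergence. -/
def haymanLog (F : ℂ → ℂ) (r : ℝ) : ℝ :=
  Real.log (F (r : ℂ)).re

/-- `a(r) = r f'(r)` with `f = ln F`. -/
def haymanA (F : ℂ → ℂ) (r : ℝ) : ℝ :=
  r * deriv (haymanLog F) r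

/-- `b(r) = r² f''(r) + r f'(r)` with `f = ln F`. -/
def haymanB (F : ℂ → ℂ) (r : ℝ) : ℝ :=
  r ^ 2 * deriv (deriv (haymanLog F)) r + r * deriv (haymanLog F) r

/-- `F` is H-admissible with finite radius of convergence `ρ`, and the split between the locality
and the decay condition can be made at `|θ| = θ₀(r)`. -/
structure IsHAdmissibleWith (F : ℂ → ℂ) (ρ : ℝ) (θ₀ : ℝ → ℝ) : Prop where
  radius_pos : 0 < ρ
  /-- `F` is the sum of a power series about `0` with radius of convergence exactly `ρ`. -/
  hasPowerSeries : ∃ P : FormalMultilinearSeries ℂ ℂ ℂ,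
    P.radius = ENNReal.ofReal ρ ∧ HasFPowerSeriesOnBall F P 0 (ENNReal.ofReal ρ)
  /-- On some interval `(R₀, ρ) ⊆ (0, ρ)` both `F` and `θ₀` are positive. -/
  positive : ∃ R₀ : ℝ, 0 ≤ R₀ ∧ R₀ < ρ ∧ ∀ r : ℝ, R₀ < r → r < ρ →
    (F (r : ℂ)).im = 0 ∧ 0 < (F (r : ℂ)).re ∧ 0 < θ₀ r
  /-- Capture condition, first half. -/
  capture_a : Tendsto (haymanA F) (𝓝[<] ρ) atTop
  /-- Capture condition, second half. -/
  capture_b : Tendsto (haymanB F) (𝓝[<] ρ) atTop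
  /-- Locality condition: `F(r e^{iθ}) ∼ F(r) exp(iθ a(r) - θ² b(r) / 2)` as `r → ρ`, uniformly in
  `|θ| ≤ θ₀(r)`. -/
  locality : ∀ η : ℝ, 0 < η → ∀ᶠ r : ℝ in 𝓝[<] ρ, ∀ θ : ℝ, |θ| ≤ θ₀ r →
    ‖F ((r : ℂ) * Complex.exp (Complex.I * (θ : ℂ))) /
        (F (r : ℂ) * Complex.exp
          (Complex.I * (θ : ℂ) * (haymanA F r : ℂ) - (θ : ℂ) ^ 2 / 2 * (haymanB F r : ℂ))) - 1‖
      ≤ η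
  /-- Decay condition: `F(r e^{iθ}) = o(b(r)^{-1/2} F(r))` as `r → ρ`, uniformly in
  `θ₀(r) ≤ |θ| < π`. -/
  decay : ∀ η : ℝ, 0 < η → ∀ᶠ r : ℝ in 𝓝[<] ρ, ∀ θ : ℝ, θ₀ r ≤ |θ| → |θ| < Real.pi →
    ‖F ((r : ℂ) * Complex.exp (Complex.I * (θ : ℂ)))‖
      ≤ η * ((haymanB F r) ^ (-(1 / 2) : ℝ) * ‖F (r : ℂ)‖)

/-- `F` is H-admissible with finite radius of convergence `ρ`. -/
def IsHAdmissible (F : ℂ → ℂ) (ρ : ℝ) : Prop :=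
  ∃ θ₀ : ℝ → ℝ, IsHAdmissibleWith F ρ θ₀

/-- `θ₀ = χ^{1+δ}`, where `χ = ln (ρ / r)`, that is `r = ρ e^{-χ}`. -/
def thetaCut (ρ δ : ℝ) (r : ℝ) : ℝ :=
  Real.log (ρ / r) ^ (1 + δ)

end

/-! Both functions have the form F = exp(D) · ∏ W_i, where D and the W_i are sums ∑_j v_j C(x^(j+1))
with v_0 = 1 and v_j polynomially bounded. For S the weights v_j vanish beyond j = 0; for G they are
1/(j+1) in the exponent and (j+1)^(p_i) in the factors. Each such sum is a power series with
non-negative coefficients, kept as a family indexed by pairs (j, k), of degree (j+1)(k+1). Write D_m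
for the m-th degree moment of D at r, and χ = log(ρ/r). Since r d/dr raises the order of a moment by
one, a = D_1 + ∑ means and b = D_2 + ∑ variances, the means and variances being those of the degrees
in the W_i.

Locality: D(re^{iθ}) differs from its quadratic expansion in θ by O(|θ|³ D_3). The upper bound on
c_n gives D_3 = O(χ^(-α-3)), so for |θ| ≤ χ^(1+δ) the error is O(χ^(3δ-α)), which vanishes because δ
> α/3. For the factors it is enough that θ · mean and θ² · (second moment / mass) tend to 0. Degrees
beyond χ^(-1-δ/2) carry exponentially small weight, so the normalised k-th moment is o(χ^(-k(1+δ)))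
(`tendsto_thetaCut_pow_mul_moment_div`).

Decay: |W_i(re^{iθ})| ≤ W_i(r), so all the loss comes from D_0 - Re D(re^{iθ}) = ∑ w r^d (1 - cos
dθ). The lower bound on c_n, used only for n of order 1/χ, makes this at least a χ^(-β) min(1,
(θ/χ)²) with β = 2α/3 + ε (`exists_le_sum_mul_one_sub_cos`). For |θ| ≥ χ^(1+δ) that is at least a
χ^(-(β-2δ)), where β > 2δ because δ < α/3 + ε/2. The resulting stretched-exponential factor beats
b^(-1/2), since b grows at most polynomially in 1/χ. -/

/-! ### Degree series: moments and expansions in the angle. -/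

/-- The series `∑ w i * x ^ d i` over an arbitrary index type. -/
noncomputable def degreeSeries {ι : Type*} (w : ι → ℝ) (d : ι → ℕ) (x : ℂ) : ℂ :=
  ∑' i, (w i : ℂ) * x ^ d i

/-- The moments `∑ w i * (d i) ^ k * r ^ d i` of the degrees. -/
noncomputable def degreeMoment {ι : Type*} (w : ι → ℝ) (d : ι → ℕ) (k : ℕ) (r : ℝ) : ℝ :=
  ∑' i, w i * (d i : ℝ) ^ k * r ^ d i

/-- Non-negative weights and positive degrees whose moments converge on `[0, ρ)`. -/
structure IsDegreeSeries {ι : Type*} (w : ι → ℝ) (d : ι → ℕ) (ρ : ℝ) : Prop where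
  nonneg : ∀ i, 0 ≤ w i
  deg_pos : ∀ i, 1 ≤ d i
  summable : ∀ (k : ℕ) (r : ℝ), 0 ≤ r → r < ρ → Summable fun i => w i * (d i : ℝ) ^ k * r ^ d i

/-- Taylor's theorem for |x| ≤ 1. For |x| > 1 each term is crudely dominated by |x|³, which is why
the constant is not sharp. -/
theorem norm_exp_I_mul_sub_quadratic_le (x : ℝ) :
    ‖Complex.exp (Complex.I * x) - (1 + Complex.I * x - (x : ℂ) ^ 2 / 2)‖ ≤ 4 * |x| ^ 3 := by
  rcases le_or_gt |x| 1 with h | h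
  · have hn : ‖Complex.I * (x : ℂ)‖ = |x| := by simp
    have h1 := Complex.exp_bound (x := Complex.I * x) (by rw [hn]; exact h) (n := 3) (by norm_num)
    rw [hn] at h1
    have h2 : ∑ m ∈ Finset.range 3, (Complex.I * (x : ℂ)) ^ m / (m.factorial : ℂ)
        = 1 + Complex.I * x - (x : ℂ) ^ 2 / 2 := by
      simp [Finset.sum_range_succ, mul_pow]
      ring
    rw [h2] at h1
    refine h1.trans ?_
    have : 0 ≤ |x| ^ 3 := by positivity
    norm_num [Nat.factorial]
    linarith
  · have h1 : ‖Complex.exp (Complex.I * x)‖ = 1 := by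
      rw [mul_comm]; exact Complex.norm_exp_ofReal_mul_I x
    have h2 : ‖1 + Complex.I * (x : ℂ) - (x : ℂ) ^ 2 / 2‖ ≤ 1 + |x| + |x| ^ 2 / 2 := by
      refine (norm_sub_le _ _).trans ?_
      refine add_le_add ((norm_add_le _ _).trans ?_) ?_ <;> simp
    refine (norm_sub_le _ _).trans ?_
    nlinarith [sq_nonneg |x|, mul_pos (sub_pos.2 h) (sub_pos.2 h), pow_le_pow_left₀ zero_le_one h.le 3,
      pow_le_pow_right₀ h.le (show 1 ≤ 3 by norm_num), pow_le_pow_right₀ h.le (show 2 ≤ 3 by norm_num)]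

namespace IsDegreeSeries

variable {ι : Type*} {w : ι → ℝ} {d : ι → ℕ} {ρ : ℝ}

theorem moment_term_nonneg (h : IsDegreeSeries w d ρ) (k : ℕ) {r : ℝ} (hr : 0 ≤ r) (i : ι) :
    0 ≤ w i * (d i : ℝ) ^ k * r ^ d i :=
  mul_nonneg (mul_nonneg (h.nonneg i) (by positivity)) (by positivity)

theorem moment_nonneg (h : IsDegreeSeries w d ρ) (k : ℕ) {r : ℝ} (hr : 0 ≤ r) :
    0 ≤ degreeMoment w d k r :=
  tsum_nonneg fun i => h.moment_term_nonneg k hr i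

theorem moment_le_moment (h : IsDegreeSeries w d ρ) {k l : ℕ} (hkl : k ≤ l) {r : ℝ} (hr : 0 ≤ r)
    (hrρ : r < ρ) : degreeMoment w d k r ≤ degreeMoment w d l r := by
  refine (h.summable k r hr hrρ).tsum_le_tsum (fun i => ?_) (h.summable l r hr hrρ)
  have h1 : (1 : ℝ) ≤ d i := by exact_mod_cast h.deg_pos i
  have := h.nonneg i
  gcongr

theorem moment_pos (h : IsDegreeSeries w d ρ) {i : ι} (hi : 0 < w i) (k : ℕ) {r : ℝ} (hr : 0 < r)
    (hrρ : r < ρ) : 0 < degreeMoment w d k r := by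
  refine (h.summable k r hr.le hrρ).tsum_pos (fun i => h.moment_term_nonneg k hr.le i) i ?_
  have h1 : (0 : ℝ) < d i := by exact_mod_cast h.deg_pos i
  positivity

/-- Termwise differentiation, dominated on (0, R) by the terms at an intermediate radius r < R < ρ.
-/
theorem hasDerivAt_moment (h : IsDegreeSeries w d ρ) (k : ℕ) {r : ℝ} (hr : 0 < r)
    (hrρ : r < ρ) :
    HasDerivAt (degreeMoment w d k) (degreeMoment w d (k + 1) r / r) r := by
  obtain ⟨R, hrR, hRρ⟩ := exists_between hrρ
  have hR : 0 < R := hr.trans hrR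
  have hu : Summable fun i => w i * (d i : ℝ) ^ (k + 1) * R ^ d i / R :=
    (h.summable (k + 1) R hR.le hRρ).div_const R
  have key := hasDerivAt_tsum_of_isPreconnected (𝕜 := ℝ) (t := Set.Ioo 0 R) (y₀ := r) (y := r)
    (g := fun i y => w i * (d i : ℝ) ^ k * y ^ d i)
    (g' := fun i y => w i * (d i : ℝ) ^ k * ((d i : ℝ) * y ^ (d i - 1))) hu isOpen_Ioo
    isPreconnected_Ioo (fun i y _ => (hasDerivAt_pow (d i) y).const_mul _) ?_ ⟨hr, hrR⟩
    (h.summable k r hr.le hrρ) ⟨hr, hrR⟩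
  · refine key.congr_deriv ?_
    rw [degreeMoment, ← tsum_div_const]
    refine tsum_congr fun i => ?_
    obtain ⟨m, hm⟩ := Nat.exists_eq_add_of_le' (h.deg_pos i)
    rw [hm]
    simp only [Nat.add_sub_cancel]
    field_simp
    ring
  · intro i y hy
    obtain ⟨m, hm⟩ := Nat.exists_eq_add_of_le' (h.deg_pos i)
    have hw := h.nonneg i
    have hy0 : 0 ≤ y := hy.1.le
    rw [Real.norm_of_nonneg (by positivity)]
    have e : w i * (d i : ℝ) ^ (k + 1) * R ^ d i / R
        = w i * (d i : ℝ) ^ k * ((d i : ℝ) * R ^ (d i - 1)) := by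
      rw [hm]
      simp only [Nat.add_sub_cancel]
      field_simp
      ring
    rw [e]
    have := hy.2.le
    gcongr

theorem summable_norm (h : IsDegreeSeries w d ρ) {x : ℂ} (hx : ‖x‖ < ρ) :
    Summable fun i => ‖(w i : ℂ) * x ^ d i‖ := by
  refine (h.summable 0 ‖x‖ (norm_nonneg x) hx).congr fun i => ?_
  simp [abs_of_nonneg (h.nonneg i)]

theorem norm_series_le (h : IsDegreeSeries w d ρ) {x : ℂ} (hx : ‖x‖ < ρ) :
    ‖degreeSeries w d x‖ ≤ degreeMoment w d 0 ‖x‖ := by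
  refine (norm_tsum_le_tsum_norm (h.summable_norm hx)).trans (le_of_eq (tsum_congr fun i => ?_))
  simp [abs_of_nonneg (h.nonneg i)]

theorem series_ofReal (w : ι → ℝ) (d : ι → ℕ) (r : ℝ) :
    degreeSeries w d (r : ℂ) = (degreeMoment w d 0 r : ℂ) := by
  simp [degreeSeries, degreeMoment, Complex.ofReal_tsum]

theorem differentiableOn_series (h : IsDegreeSeries w d ρ) :
    DifferentiableOn ℂ (degreeSeries w d) (Metric.ball 0 ρ) := by
  intro x hx
  rw [mem_ball_zero_iff] at hx
  obtain ⟨R, hxR, hRρ⟩ := exists_between hx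
  have hR : 0 < R := (norm_nonneg x).trans_lt hxR
  have key : DifferentiableOn ℂ (degreeSeries w d) (Metric.ball 0 R) := by
    refine Complex.differentiableOn_tsum_of_summable_norm
      (u := fun i => w i * (d i : ℝ) ^ 0 * R ^ d i) (h.summable 0 R hR.le hRρ)
      (fun i => by fun_prop) Metric.isOpen_ball fun i y hy => ?_
    rw [mem_ball_zero_iff] at hy
    have hw := h.nonneg i
    simp only [norm_mul, norm_pow, Complex.norm_real, Real.norm_of_nonneg hw, pow_zero, mul_one]
    gcongr
  exact (key.differentiableAt (Metric.isOpen_ball.mem_nhds (by simpa using hxR))).differentiableWithinAt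

theorem norm_polar {r : ℝ} (hr : 0 ≤ r) (θ : ℝ) :
    ‖(r : ℂ) * Complex.exp (Complex.I * (θ : ℂ))‖ = r := by
  rw [norm_mul, mul_comm Complex.I, Complex.norm_exp_ofReal_mul_I, mul_one, Complex.norm_real,
    Real.norm_of_nonneg hr]

theorem polar_pow (r θ : ℝ) (n : ℕ) :
    ((r : ℂ) * Complex.exp (Complex.I * (θ : ℂ))) ^ n
      = (r : ℂ) ^ n * Complex.exp (Complex.I * ((n * θ : ℝ) : ℂ)) := by
  rw [mul_pow, ← Complex.exp_nat_mul]
  congr 2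
  push_cast
  ring

theorem hasSum_moment (h : IsDegreeSeries w d ρ) (k : ℕ) {r : ℝ} (hr : 0 ≤ r) (hrρ : r < ρ) :
    HasSum (fun i => w i * (d i : ℝ) ^ k * r ^ d i) (degreeMoment w d k r) :=
  (h.summable k r hr hrρ).hasSum

theorem hasSum_polar (h : IsDegreeSeries w d ρ) {r : ℝ} (hr : 0 ≤ r) (hrρ : r < ρ) (θ : ℝ) :
    HasSum (fun i => (w i : ℂ) * ((r : ℂ) ^ d i * Complex.exp (Complex.I * ((d i * θ : ℝ) : ℂ))))
      (degreeSeries w d ((r : ℂ) * Complex.exp (Complex.I * (θ : ℂ)))) := by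
  simp_rw [← polar_pow]
  exact (h.summable_norm (by rwa [norm_polar hr])).of_norm.hasSum

/-- Apply the bound on e^{ix} with x = d_i θ to each term; non-negativity of the weights lets the
errors sum to the third moment. -/
theorem norm_series_sub_quadratic_le (h : IsDegreeSeries w d ρ) {r : ℝ} (hr : 0 ≤ r) (hrρ : r < ρ)
    (θ : ℝ) :
    ‖degreeSeries w d ((r : ℂ) * Complex.exp (Complex.I * (θ : ℂ)))
        - ((degreeMoment w d 0 r : ℂ) + Complex.I * θ * (degreeMoment w d 1 r : ℂ)
          - (θ : ℂ) ^ 2 / 2 * (degreeMoment w d 2 r : ℂ))‖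
      ≤ 4 * |θ| ^ 3 * degreeMoment w d 3 r := by
  have H := fun k => Complex.hasSum_ofReal.2 (h.hasSum_moment k hr hrρ)
  have H' := (h.hasSum_polar hr hrρ θ).sub
    (((H 0).add ((H 1).mul_left (Complex.I * θ))).sub ((H 2).mul_left ((θ : ℂ) ^ 2 / 2)))
  rw [← H'.tsum_eq]
  refine tsum_of_norm_bounded ((h.hasSum_moment 3 hr hrρ).mul_left (4 * |θ| ^ 3)) fun i => ?_
  have e : (w i : ℂ) * ((r : ℂ) ^ d i * Complex.exp (Complex.I * ((d i * θ : ℝ) : ℂ)))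
      - (((w i * (d i : ℝ) ^ 0 * r ^ d i : ℝ) : ℂ)
        + Complex.I * θ * ((w i * (d i : ℝ) ^ 1 * r ^ d i : ℝ) : ℂ)
        - (θ : ℂ) ^ 2 / 2 * ((w i * (d i : ℝ) ^ 2 * r ^ d i : ℝ) : ℂ))
      = ((w i * r ^ d i : ℝ) : ℂ) * (Complex.exp (Complex.I * ((d i * θ : ℝ) : ℂ))
        - (1 + Complex.I * ((d i * θ : ℝ) : ℂ) - ((d i * θ : ℝ) : ℂ) ^ 2 / 2)) := by
    push_cast
    ring
  have hw := h.nonneg i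
  rw [e, norm_mul, Complex.norm_real, Real.norm_of_nonneg (by positivity)]
  refine (mul_le_mul_of_nonneg_left (norm_exp_I_mul_sub_quadratic_le _) (by positivity)).trans ?_
  rw [abs_mul, Nat.abs_cast, mul_pow]
  exact le_of_eq (by ring)

theorem norm_series_sub_moment_le (h : IsDegreeSeries w d ρ) {r : ℝ} (hr : 0 ≤ r) (hrρ : r < ρ)
    (θ : ℝ) :
    ‖degreeSeries w d ((r : ℂ) * Complex.exp (Complex.I * (θ : ℂ))) - (degreeMoment w d 0 r : ℂ)‖
      ≤ |θ| * degreeMoment w d 1 r := by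
  have H' := (h.hasSum_polar hr hrρ θ).sub (Complex.hasSum_ofReal.2 (h.hasSum_moment 0 hr hrρ))
  rw [← H'.tsum_eq]
  refine tsum_of_norm_bounded ((h.hasSum_moment 1 hr hrρ).mul_left |θ|) fun i => ?_
  have e : (w i : ℂ) * ((r : ℂ) ^ d i * Complex.exp (Complex.I * ((d i * θ : ℝ) : ℂ)))
      - ((w i * (d i : ℝ) ^ 0 * r ^ d i : ℝ) : ℂ)
      = ((w i * r ^ d i : ℝ) : ℂ) * (Complex.exp (Complex.I * ((d i * θ : ℝ) : ℂ)) - 1) := by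
    push_cast
    ring
  have hw := h.nonneg i
  rw [e, norm_mul, Complex.norm_real, Real.norm_of_nonneg (by positivity)]
  refine (mul_le_mul_of_nonneg_left Real.norm_exp_I_mul_ofReal_sub_one_le (by positivity)).trans ?_
  rw [norm_mul, Real.norm_eq_abs, Real.norm_eq_abs, Nat.abs_cast]
  exact le_of_eq (by ring)

theorem hasSum_moment_sub_re (h : IsDegreeSeries w d ρ) {r : ℝ} (hr : 0 ≤ r) (hrρ : r < ρ)
    (θ : ℝ) :
    HasSum (fun i => w i * r ^ d i * (1 - Real.cos (d i * θ)))
      (degreeMoment w d 0 r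
        - (degreeSeries w d ((r : ℂ) * Complex.exp (Complex.I * (θ : ℂ)))).re) := by
  have H := (h.hasSum_moment 0 hr hrρ).sub (Complex.hasSum_re (h.hasSum_polar hr hrρ θ))
  refine (congrArg (HasSum · _) (funext fun i => ?_)).mp H
  symm
  rw [← Complex.ofReal_pow, Complex.re_ofReal_mul, Complex.re_ofReal_mul, mul_comm Complex.I,
    Complex.exp_ofReal_mul_I_re]
  ring

/-- Cauchy–Schwarz: the variance of the degrees is non-negative. -/
theorem moment_one_sq_le (h : IsDegreeSeries w d ρ) {r : ℝ} (hr : 0 ≤ r) (hrρ : r < ρ)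
    (h0 : 0 < degreeMoment w d 0 r) :
    (degreeMoment w d 1 r / degreeMoment w d 0 r) ^ 2
      ≤ degreeMoment w d 2 r / degreeMoment w d 0 r := by
  -- With μ the mean, the inequality is ∑ w r^d (d - μ)² ≥ 0 expanded.
  set μ := degreeMoment w d 1 r / degreeMoment w d 0 r with hμ
  have H := (((h.hasSum_moment 2 hr hrρ).sub ((h.hasSum_moment 1 hr hrρ).mul_left (2 * μ))).add
    ((h.hasSum_moment 0 hr hrρ).mul_left (μ ^ 2)))
  have h1 := H.nonneg fun i => by
    have hw := h.nonneg i
    have e : w i * (d i : ℝ) ^ 2 * r ^ d i - 2 * μ * (w i * (d i : ℝ) ^ 1 * r ^ d i)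
        + μ ^ 2 * (w i * (d i : ℝ) ^ 0 * r ^ d i) = w i * r ^ d i * ((d i : ℝ) - μ) ^ 2 := by ring
    rw [e]
    positivity
  have h2 : degreeMoment w d 1 r = μ * degreeMoment w d 0 r := by
    rw [hμ]; field_simp
  rw [h2] at h1
  rw [le_div_iff₀ h0]
  nlinarith

/-- Splitting a moment at degree `N`: beyond `N` half of the exponential decay is given away. -/
theorem moment_le_split (h : IsDegreeSeries w d ρ) (k : ℕ) {r χ N : ℝ} (hr : 0 ≤ r)
    (hχ : 0 ≤ χ) (hN : 0 ≤ N) (hrρ : r * Real.exp χ < ρ) :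
    degreeMoment w d k r
      ≤ N ^ k * degreeMoment w d 0 r
        + Real.exp (-(N * χ)) * degreeMoment w d k (r * Real.exp χ) := by
  have hrρ' : r < ρ := (le_mul_of_one_le_right hr (Real.one_le_exp hχ)).trans_lt hrρ
  have hr' : 0 ≤ r * Real.exp χ := by positivity
  refine hasSum_le (fun i => ?_) (h.hasSum_moment k hr hrρ')
    (((h.hasSum_moment 0 hr hrρ').mul_left (N ^ k)).add
      ((h.hasSum_moment k hr' hrρ).mul_left (Real.exp (-(N * χ)))))
  have hw := h.nonneg i
  rcases le_total (d i : ℝ) N with hd | hd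
  · have h1 : w i * (d i : ℝ) ^ k * r ^ d i ≤ w i * N ^ k * r ^ d i := by gcongr
    have h2 : 0 ≤ Real.exp (-(N * χ)) * (w i * (d i : ℝ) ^ k * (r * Real.exp χ) ^ d i) := by
      positivity
    linarith
  · have h2 : 0 ≤ N ^ k * (w i * (d i : ℝ) ^ 0 * r ^ d i) := by positivity
    have h3 : Real.exp (-(N * χ)) * (w i * (d i : ℝ) ^ k * (r * Real.exp χ) ^ d i)
        = w i * (d i : ℝ) ^ k * r ^ d i * Real.exp ((d i - N) * χ) := by
      rw [mul_pow, ← Real.exp_nat_mul, show ((d i : ℝ) - N) * χ = -(N * χ) + d i * χ by ring,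
        Real.exp_add]
      ring
    have h4 : 1 ≤ Real.exp (((d i : ℝ) - N) * χ) :=
      Real.one_le_exp (mul_nonneg (sub_nonneg.2 hd) hχ)
    have h5 := le_mul_of_one_le_right (h.moment_term_nonneg k hr i) h4
    linarith

end IsDegreeSeries

/-! ### Upper bounds for polylogarithmic sums. -/

/-- Raise y ≤ e^y at y = x / (2(s+1)) to the power s. Half of an exponential thus absorbs the power,
leaving the other half for a geometric series. -/
theorem rpow_le_mul_exp_half {s x : ℝ} (hs : 0 ≤ s) (hx : 0 ≤ x) :
    x ^ s ≤ (2 * (s + 1)) ^ s * Real.exp (x / 2) := by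
  have h1 : x / (2 * (s + 1)) ≤ Real.exp (x / (2 * (s + 1))) := by
    linarith [Real.add_one_le_exp (x / (2 * (s + 1)))]
  have h2 : x = 2 * (s + 1) * (x / (2 * (s + 1))) := by field_simp
  calc x ^ s = (2 * (s + 1)) ^ s * (x / (2 * (s + 1))) ^ s := by
        rw [← Real.mul_rpow (by positivity) (by positivity), ← h2]
    _ ≤ (2 * (s + 1)) ^ s * Real.exp (x / (2 * (s + 1))) ^ s := by gcongr
    _ ≤ (2 * (s + 1)) ^ s * Real.exp (x / 2) := by
        rw [← Real.exp_mul]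
        gcongr
        rw [div_mul_eq_mul_div, div_le_div_iff₀ (by positivity) two_pos]
        nlinarith

/-- Polylogarithm-type sums `∑ n ^ s * e ^ (-n y)` are `O(y ^ (-s - 1))`. -/
theorem exists_tsum_rpow_mul_exp_le {s : ℝ} (hs : 0 ≤ s) :
    ∃ K : ℝ, 0 < K ∧ ∀ y : ℝ, 0 < y →
      Summable (fun k : ℕ => ((k : ℝ) + 1) ^ s * Real.exp (-(((k : ℝ) + 1) * y))) ∧
      ∑' k : ℕ, ((k : ℝ) + 1) ^ s * Real.exp (-(((k : ℝ) + 1) * y)) ≤ K * y ^ (-s - 1) := by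
  refine ⟨2 * (2 * (s + 1)) ^ s, by positivity, fun y hy => ?_⟩
  set q := Real.exp (-(y / 2)) with hq
  have hq0 : 0 < q := Real.exp_pos _
  have hq1 : q < 1 := Real.exp_lt_one_iff.2 (by linarith)
  have hterm : ∀ k : ℕ, ((k : ℝ) + 1) ^ s * Real.exp (-(((k : ℝ) + 1) * y))
      ≤ y ^ (-s) * (2 * (s + 1)) ^ s * q * q ^ k := by
    intro k
    have h1 := rpow_le_mul_exp_half hs (show 0 ≤ ((k : ℝ) + 1) * y by positivity)
    have h2 : ((k : ℝ) + 1) ^ s = y ^ (-s) * (((k : ℝ) + 1) * y) ^ s := by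
      rw [Real.mul_rpow (by positivity) hy.le, Real.rpow_neg hy.le]
      field_simp
    have h3 : q * q ^ k = Real.exp (((k : ℝ) + 1) * y / 2) * Real.exp (-(((k : ℝ) + 1) * y)) := by
      rw [hq, ← Real.exp_nat_mul, ← Real.exp_add, ← Real.exp_add]
      congr 1
      ring
    rw [h2, mul_assoc (y ^ (-s) * _), h3]
    calc y ^ (-s) * (((k : ℝ) + 1) * y) ^ s * Real.exp (-(((k : ℝ) + 1) * y))
        ≤ y ^ (-s) * ((2 * (s + 1)) ^ s * Real.exp (((k : ℝ) + 1) * y / 2))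
          * Real.exp (-(((k : ℝ) + 1) * y)) := by gcongr
      _ = _ := by ring
  have hgeo : Summable fun k : ℕ => y ^ (-s) * (2 * (s + 1)) ^ s * q * q ^ k :=
    (summable_geometric_of_lt_one hq0.le hq1).mul_left _
  have hsum := hgeo.of_nonneg_of_le (fun k => by positivity) hterm
  refine ⟨hsum, (hsum.tsum_le_tsum hterm hgeo).trans ?_⟩
  rw [tsum_mul_left, tsum_geometric_of_lt_one hq0.le hq1]
  have h4 : q * (1 - q)⁻¹ ≤ 2 * y⁻¹ := by
    rw [← div_eq_mul_inv, ← div_eq_mul_inv, div_le_div_iff₀ (by linarith) hy]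
    have h5 : q * Real.exp (y / 2) = 1 := by rw [hq, ← Real.exp_add]; simp
    nlinarith [Real.add_one_le_exp (y / 2)]
  calc y ^ (-s) * (2 * (s + 1)) ^ s * q * (1 - q)⁻¹
      = y ^ (-s) * (2 * (s + 1)) ^ s * (q * (1 - q)⁻¹) := by ring
    _ ≤ y ^ (-s) * (2 * (s + 1)) ^ s * (2 * y⁻¹) := by gcongr
    _ = _ := by
        rw [sub_eq_add_neg, Real.rpow_add hy, Real.rpow_neg_one]
        ring

/-- The inner sum in row j is O(((j+1)y)^(-s-1)), so the rows add up to a multiple of ∑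
(j+1)^(q-s-1), which converges because q < s. -/
theorem exists_tsum_prod_rpow_mul_exp_le {q s : ℝ} (hs : 0 ≤ s) (hqs : q < s) :
    ∃ K : ℝ, 0 < K ∧ ∀ y : ℝ, 0 < y →
      Summable (fun i : ℕ × ℕ => ((i.1 : ℝ) + 1) ^ q * (((i.2 : ℝ) + 1) ^ s
        * Real.exp (-(((i.2 : ℝ) + 1) * (((i.1 : ℝ) + 1) * y))))) ∧
      ∑' i : ℕ × ℕ, ((i.1 : ℝ) + 1) ^ q * (((i.2 : ℝ) + 1) ^ s
        * Real.exp (-(((i.2 : ℝ) + 1) * (((i.1 : ℝ) + 1) * y)))) ≤ K * y ^ (-s - 1) := by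
  obtain ⟨K, hK, H⟩ := exists_tsum_rpow_mul_exp_le hs
  have hz : Summable fun j : ℕ => ((j : ℝ) + 1) ^ (q - s - 1) := by
    have := (summable_nat_add_iff 1).2 (Real.summable_nat_rpow.2 (show q - s - 1 < -1 by linarith))
    simpa using this
  have hz0 : 0 < ∑' j : ℕ, ((j : ℝ) + 1) ^ (q - s - 1) :=
    hz.tsum_pos (fun j => by positivity) 0 (by positivity)
  refine ⟨K * ∑' j : ℕ, ((j : ℝ) + 1) ^ (q - s - 1), by positivity, fun y hy => ?_⟩
  have hj : ∀ j : ℕ, 0 < ((j : ℝ) + 1) * y := fun j => by positivity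
  have hinner : ∀ j : ℕ, ∑' k : ℕ, ((j : ℝ) + 1) ^ q * (((k : ℝ) + 1) ^ s
      * Real.exp (-(((k : ℝ) + 1) * (((j : ℝ) + 1) * y))))
      ≤ K * y ^ (-s - 1) * ((j : ℝ) + 1) ^ (q - s - 1) := by
    intro j
    rw [tsum_mul_left]
    calc _ ≤ ((j : ℝ) + 1) ^ q * (K * (((j : ℝ) + 1) * y) ^ (-s - 1)) := by
          gcongr
          exact (H _ (hj j)).2
      _ = _ := by
          rw [Real.mul_rpow (by positivity) hy.le, show q - s - 1 = q + (-s - 1) by ring,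
            Real.rpow_add (by positivity)]
          ring
  have hsum : Summable (fun i : ℕ × ℕ => ((i.1 : ℝ) + 1) ^ q * (((i.2 : ℝ) + 1) ^ s
      * Real.exp (-(((i.2 : ℝ) + 1) * (((i.1 : ℝ) + 1) * y))))) := by
    have hnn : ∀ i : ℕ × ℕ, 0 ≤ ((i.1 : ℝ) + 1) ^ q * (((i.2 : ℝ) + 1) ^ s
      * Real.exp (-(((i.2 : ℝ) + 1) * (((i.1 : ℝ) + 1) * y)))) := fun i => by positivity
    have hrow : ∀ j : ℕ, Summable fun k : ℕ => ((j : ℝ) + 1) ^ q * (((k : ℝ) + 1) ^ s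
      * Real.exp (-(((k : ℝ) + 1) * (((j : ℝ) + 1) * y)))) :=
      fun j => (H (((j : ℝ) + 1) * y) (hj j)).1.mul_left (((j : ℝ) + 1) ^ q)
    refine (summable_prod_of_nonneg hnn).2 ⟨hrow, ?_⟩
    exact (hz.mul_left (K * y ^ (-s - 1))).of_nonneg_of_le
      (fun j => tsum_nonneg fun k => by positivity) hinner
  refine ⟨hsum, ?_⟩
  rw [hsum.tsum_prod]
  refine (hsum.prod.tsum_le_tsum hinner (hz.mul_left _)).trans (le_of_eq ?_)
  rw [tsum_mul_left]
  ring

/-! ### Lower bounds for cosine sums. -/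

/-- As 2(1 - cos t) = |e^{it} - 1|², this is the triangle inequality through 1 followed by (x + y)²
≤ 2x² + 2y². -/
theorem one_sub_cos_sub_le (a b : ℝ) :
    1 - Real.cos (b - a) ≤ 2 * (1 - Real.cos a) + 2 * (1 - Real.cos b) := by
  rw [Real.cos_sub]
  nlinarith [sq_nonneg (Real.cos a + Real.cos b - 2), sq_nonneg (Real.sin a + Real.sin b),
    Real.sin_sq_add_cos_sq a, Real.sin_sq_add_cos_sq b]

/-- If N|θ| ≤ π, take m = N and use the quadratic bound on the cosine, with 2/π² ≥ 1/5. Otherwise m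
= ⌊π/|θ|⌋ puts m|θ| in [π/2, π], where the cosine is non-positive. -/
theorem exists_le_one_sub_cos (N : ℕ) {θ : ℝ} (hθ : |θ| ≤ Real.pi) :
    ∃ m : ℕ, m ≤ N ∧ min 1 ((N * θ) ^ 2 / 5) ≤ 1 - Real.cos (m * θ) := by
  have hpi := Real.pi_pos
  rcases le_or_gt (N * |θ|) Real.pi with h | h
  · refine ⟨N, le_rfl, (min_le_right _ _).trans ?_⟩
    have h1 : |N * θ| ≤ Real.pi := by rwa [abs_mul, Nat.abs_cast]
    have h2 := Real.cos_le_one_sub_mul_cos_sq h1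
    have h3 : (1 : ℝ) / 5 ≤ 2 / Real.pi ^ 2 := by
      rw [div_le_div_iff₀ (by norm_num) (by positivity)]
      nlinarith [Real.pi_lt_d2]
    nlinarith [sq_nonneg ((N : ℝ) * θ)]
  · have hθ0 : 0 < |θ| := by
      rcases (abs_nonneg θ).eq_or_lt with h0 | h0
      · rw [← h0, mul_zero] at h; linarith
      · exact h0
    have h1 : 1 ≤ Real.pi / |θ| := (one_le_div hθ0).2 hθ
    have h2 : 1 ≤ ⌊Real.pi / |θ|⌋₊ := Nat.le_floor (by simpa using h1)
    refine ⟨⌊Real.pi / |θ|⌋₊, ?_, (min_le_left _ _).trans ?_⟩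
    · exact Nat.floor_le_of_le (by rw [div_le_iff₀ hθ0]; exact h.le)
    · have h3 : (⌊Real.pi / |θ|⌋₊ : ℝ) * |θ| ≤ Real.pi := by
        rw [← le_div_iff₀ hθ0]; exact Nat.floor_le (by positivity)
      have h4 : Real.pi < (⌊Real.pi / |θ|⌋₊ + 1 : ℝ) * |θ| := by
        rw [← div_lt_iff₀ hθ0]; exact Nat.lt_floor_add_one _
      have h5 : (1 : ℝ) ≤ (⌊Real.pi / |θ|⌋₊ : ℝ) := by exact_mod_cast h2
      have h6 := Real.cos_nonpos_of_pi_div_two_le_of_le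
        (x := (⌊Real.pi / |θ|⌋₊ : ℝ) * |θ|) (by nlinarith) (by linarith)
      rw [← Real.cos_abs, abs_mul, Nat.abs_cast]
      linarith

/-- A single good shift m ≤ N suffices: nθ and (n+m)θ cannot both be close to 2πℤ when mθ is not.
Averaging over n in [N, 2N) stays inside the window [N, 3N]. -/
theorem mul_min_le_sum_one_sub_cos (N : ℕ) {θ : ℝ} (hθ : |θ| ≤ Real.pi) :
    N * min 1 ((N * θ) ^ 2 / 5) ≤ 4 * ∑ n ∈ Finset.Icc N (3 * N), (1 - Real.cos (n * θ)) := by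
  obtain ⟨m, hm, hle⟩ := exists_le_one_sub_cos N hθ
  have hnn : ∀ n : ℕ, 0 ≤ 1 - Real.cos (n * θ) := fun n => by linarith [Real.cos_le_one (n * θ)]
  have h1 : ∑ n ∈ Finset.Ico N (2 * N), (1 - Real.cos (n * θ))
      ≤ ∑ n ∈ Finset.Icc N (3 * N), (1 - Real.cos (n * θ)) := by
    refine Finset.sum_le_sum_of_subset_of_nonneg (fun n hn => ?_) fun n _ _ => hnn n
    simp only [Finset.mem_Ico, Finset.mem_Icc] at hn ⊢
    omega
  have h2 : ∑ n ∈ Finset.Ico N (2 * N), (1 - Real.cos ((n + m : ℕ) * θ))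
      ≤ ∑ n ∈ Finset.Icc N (3 * N), (1 - Real.cos (n * θ)) := by
    rw [Finset.sum_Ico_add' (fun n : ℕ => 1 - Real.cos (n * θ)) N (2 * N) m]
    refine Finset.sum_le_sum_of_subset_of_nonneg (fun n hn => ?_) fun n _ _ => hnn n
    simp only [Finset.mem_Ico, Finset.mem_Icc] at hn ⊢
    omega
  have h3 : (N : ℝ) * min 1 ((N * θ) ^ 2 / 5) = ∑ n ∈ Finset.Ico N (2 * N),
      min 1 ((N * θ) ^ 2 / 5) := by
    rw [Finset.sum_const, Nat.card_Ico, nsmul_eq_mul]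
    congr 2
    omega
  rw [h3]
  calc _ ≤ ∑ n ∈ Finset.Ico N (2 * N), (2 * (1 - Real.cos (n * θ))
        + 2 * (1 - Real.cos ((n + m : ℕ) * θ))) := by
        refine Finset.sum_le_sum fun n _ => hle.trans ?_
        have := one_sub_cos_sub_le (n * θ) ((n + m : ℕ) * θ)
        rwa [show ((n + m : ℕ) : ℝ) * θ - n * θ = m * θ by push_cast; ring] at this
    _ ≤ _ := by
        rw [Finset.sum_add_distrib, ← Finset.mul_sum, ← Finset.mul_sum]
        linarith

theorem mul_exp_neg_log_div {ρ r : ℝ} (hρ : 0 < ρ) (hr : 0 < r) :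
    ρ * Real.exp (-Real.log (ρ / r)) = r := by
  rw [Real.exp_neg, Real.exp_log (by positivity)]
  field_simp

theorem log_div_pos {ρ r : ℝ} (hr : 0 < r) (hrρ : r < ρ) : 0 < Real.log (ρ / r) :=
  Real.log_pos ((one_lt_div hr).2 hrρ)

/-- The terms with index between `1 / χ` and `6 / χ` already make `∑ c n r ^ n (1 - cos (n θ))`
large. -/
theorem exists_le_sum_mul_one_sub_cos {A β ρ : ℝ} (hA : 0 < A) (hβ : 0 < β) (hρ : 0 < ρ)
    {c : ℕ → ℝ} (hc : ∀ᶠ n : ℕ in atTop, A * (n : ℝ) ^ (β - 1) * ρ ^ (-(n : ℤ)) ≤ c n) :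
    ∃ a χ₀ : ℝ, 0 < a ∧ 0 < χ₀ ∧ ∀ r : ℝ, 0 < r → r < ρ → Real.log (ρ / r) ≤ χ₀ →
      ∃ N : ℕ, 1 ≤ N ∧ ∀ θ : ℝ, |θ| ≤ Real.pi →
      a * Real.log (ρ / r) ^ (-β) * min 1 ((θ / Real.log (ρ / r)) ^ 2)
        ≤ ∑ n ∈ Finset.Icc N (3 * N), c n * r ^ n * (1 - Real.cos (n * θ)) := by
  obtain ⟨n₀, hn₀⟩ := eventually_atTop.1 hc
  -- In the window 1 ≤ nχ ≤ 6. This gives e^(-6) from r^n and 1/6 from (nχ)^(β-1); the remaining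
  -- 1/20 is the 1/4 and 1/5 of the cosine bound. The threshold forces N ≥ n₀ and Nχ ≤ 2.
  refine ⟨A * Real.exp (-6) / 120, min 1 (1 / (n₀ + 1)), by positivity, by positivity,
    fun r hr hrρ hχ => ?_⟩
  have hχ0 := log_div_pos hr hrρ
  have hrexp := mul_exp_neg_log_div hρ hr
  set χ := Real.log (ρ / r) with hχdef
  have hχ1 : χ ≤ 1 := hχ.trans (min_le_left _ _)
  have hχn : ((n₀ : ℝ) + 1) * χ ≤ 1 := by
    have := hχ.trans (min_le_right _ _)
    rw [le_div_iff₀ (by positivity)] at this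
    linarith
  set N := ⌈1 / χ⌉₊ with hN
  have hN1 : 1 ≤ N * χ := by
    rw [← div_le_iff₀ hχ0]; exact Nat.le_ceil _
  have hN2 : N * χ ≤ 2 := by
    have := Nat.ceil_lt_add_one (show 0 ≤ 1 / χ by positivity)
    rw [← hN] at this
    have h1 : (N : ℝ) * χ ≤ (1 / χ + 1) * χ := by gcongr
    have h2 : (1 / χ + 1) * χ = 1 + χ := by field_simp
    linarith
  refine ⟨N, Nat.ceil_pos.2 (by positivity), fun θ hθ => ?_⟩
  have hNpos : (0 : ℝ) < N := by
    by_contra h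
    nlinarith
  have hn0N : n₀ ≤ N := by
    have : (n₀ : ℝ) ≤ N := by
      by_contra h
      nlinarith
    exact_mod_cast this
  have hcoef : ∀ n ∈ Finset.Icc N (3 * N), A * Real.exp (-6) / 6 * χ ^ (1 - β) ≤ c n * r ^ n := by
    intro n hn
    rw [Finset.mem_Icc] at hn
    have hnN : (N : ℝ) ≤ n := by exact_mod_cast hn.1
    have hnN3 : (n : ℝ) ≤ 3 * N := by exact_mod_cast hn.2
    have hn1 : 1 ≤ n * χ := hN1.trans (by gcongr)
    have hn6 : n * χ ≤ 6 := by nlinarith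
    have hnpos : (0 : ℝ) < n := hNpos.trans_le hnN
    have h1 : (1 / 6 : ℝ) ≤ (n * χ) ^ (β - 1) := by
      calc (1 / 6 : ℝ) ≤ (n * χ)⁻¹ := by
            rw [one_div]; exact inv_anti₀ (by positivity) hn6
        _ = (n * χ) ^ (-1 : ℝ) := (Real.rpow_neg_one _).symm
        _ ≤ _ := Real.rpow_le_rpow_of_exponent_le hn1 (by linarith)
    have h2 : (n : ℝ) ^ (β - 1) = χ ^ (1 - β) * (n * χ) ^ (β - 1) := by
      rw [Real.mul_rpow hnpos.le hχ0.le, show 1 - β = -(β - 1) by ring, Real.rpow_neg hχ0.le]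
      field_simp
    have h3 : r ^ n = ρ ^ n * Real.exp (-(n * χ)) := by
      rw [← hrexp, mul_pow, ← Real.exp_nat_mul]
      congr 2
      ring
    have h4 : Real.exp (-6) ≤ Real.exp (-(n * χ)) := Real.exp_le_exp.2 (by linarith)
    calc A * Real.exp (-6) / 6 * χ ^ (1 - β)
        = A * (χ ^ (1 - β) * (1 / 6)) * Real.exp (-6) := by ring
      _ ≤ A * (χ ^ (1 - β) * (n * χ) ^ (β - 1)) * Real.exp (-(n * χ)) := by gcongr
      _ = A * (n : ℝ) ^ (β - 1) * ρ ^ (-(n : ℤ)) * r ^ n := by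
          rw [h2, h3, zpow_neg, zpow_natCast]
          field_simp
      _ ≤ c n * r ^ n := by
          gcongr
          exact hn₀ n (hn0N.trans hn.1)
  have hmin : min 1 ((θ / χ) ^ 2) / 5 ≤ min 1 ((N * θ) ^ 2 / 5) := by
    have h0 : (θ / χ) ^ 2 ≤ (N * θ) ^ 2 := by
      rw [div_pow, mul_pow, div_le_iff₀ (by positivity)]
      have : 1 ≤ (N * χ) ^ 2 := one_le_pow₀ hN1
      nlinarith [sq_nonneg θ]
    refine le_min ?_ ?_
    · linarith [min_le_left 1 ((θ / χ) ^ 2)]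
    · linarith [min_le_right 1 ((θ / χ) ^ 2)]
  have hmin0 : 0 ≤ min 1 ((θ / χ) ^ 2) := le_min zero_le_one (sq_nonneg _)
  have hχβ : χ ^ (-β) ≤ χ ^ (1 - β) * N := by
    rw [sub_eq_add_neg, Real.rpow_add hχ0, Real.rpow_one]
    nlinarith [Real.rpow_pos_of_pos hχ0 (-β)]
  calc A * Real.exp (-6) / 120 * χ ^ (-β) * min 1 ((θ / χ) ^ 2)
      = A * Real.exp (-6) / 24 * χ ^ (-β) * (min 1 ((θ / χ) ^ 2) / 5) := by ring
    _ ≤ A * Real.exp (-6) / 24 * (χ ^ (1 - β) * N) * min 1 ((N * θ) ^ 2 / 5) := by gcongr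
    _ = A * Real.exp (-6) / 6 * χ ^ (1 - β) / 4 * (N * min 1 ((N * θ) ^ 2 / 5)) := by ring
    _ ≤ A * Real.exp (-6) / 6 * χ ^ (1 - β) / 4
          * (4 * ∑ n ∈ Finset.Icc N (3 * N), (1 - Real.cos (n * θ))) := by
        exact mul_le_mul_of_nonneg_left (mul_min_le_sum_one_sub_cos N hθ) (by positivity)
    _ = ∑ n ∈ Finset.Icc N (3 * N), A * Real.exp (-6) / 6 * χ ^ (1 - β)
          * (1 - Real.cos (n * θ)) := by
        rw [← Finset.mul_sum]
        ring
    _ ≤ _ := by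
        refine Finset.sum_le_sum fun n hn => ?_
        exact mul_le_mul_of_nonneg_right (hcoef n hn) (by linarith [Real.cos_le_one (n * θ)])

/-! ### The series ∑ v_j C(x^(j+1)) as degree series. -/

/-- Weights of the terms of `∑ j, v j * C (x ^ (j + 1))`. -/
def clusterWeight (c v : ℕ → ℝ) (i : ℕ × ℕ) : ℝ :=
  v i.1 * c (i.2 + 1)

/-- Degrees of the terms of `∑ j, v j * C (x ^ (j + 1))`. -/
def clusterDegree (i : ℕ × ℕ) : ℕ :=
  (i.1 + 1) * (i.2 + 1)

/-- The finitely many indices before the bound takes effect are absorbed by adding their ratios to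
A₂. -/
theorem exists_forall_le_of_oscillatingExpansive {α₁ α₂ ρ : ℝ} (hρ : 0 < ρ) {c : ℕ → ℝ}
    (hc : c ∈ oscillatingExpansive α₁ α₂ ρ) :
    ∃ K : ℝ, 0 < K ∧ ∀ k : ℕ, c (k + 1) ≤ K * ((k : ℝ) + 1) ^ (α₂ - 1) * (ρ ^ (k + 1))⁻¹ := by
  obtain ⟨hc0, A₁, A₂, hA₁, hA₂, h⟩ := hc
  obtain ⟨n₀, hn₀⟩ := eventually_atTop.1 h
  have hnn : ∀ k : ℕ, 0 ≤ c (k + 1) / (((k : ℝ) + 1) ^ (α₂ - 1) * (ρ ^ (k + 1))⁻¹) :=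
    fun k => div_nonneg (hc0 _ (by omega)) (by positivity)
  have hs := Finset.sum_nonneg fun k (_ : k ∈ Finset.range n₀) => hnn k
  refine ⟨A₂ + ∑ k ∈ Finset.range n₀, c (k + 1) / (((k : ℝ) + 1) ^ (α₂ - 1) * (ρ ^ (k + 1))⁻¹),
    by linarith, fun k => ?_⟩
  have hden : 0 < ((k : ℝ) + 1) ^ (α₂ - 1) * (ρ ^ (k + 1))⁻¹ := by positivity
  rw [mul_assoc]
  rcases lt_or_ge k n₀ with hk | hk
  · rw [← div_le_iff₀ hden]
    have := Finset.single_le_sum (fun k (_ : k ∈ Finset.range n₀) => hnn k) (Finset.mem_range.2 hk)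
    linarith
  · have h1 := (hn₀ (k + 1) (by omega)).2
    rw [zpow_neg, zpow_natCast, mul_assoc] at h1
    push_cast at h1
    refine h1.trans (mul_le_mul_of_nonneg_right ?_ hden.le)
    linarith

section

variable {α ρ q K : ℝ} {c v : ℕ → ℝ}

theorem clusterWeight_nonneg (hc0 : ∀ k : ℕ, 1 ≤ k → 0 ≤ c k) (hv0 : ∀ j, 0 ≤ v j) (i : ℕ × ℕ) :
    0 ≤ clusterWeight c v i :=
  mul_nonneg (hv0 _) (hc0 _ (by omega))

theorem clusterDegree_pos (i : ℕ × ℕ) : 1 ≤ clusterDegree i :=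
  Nat.mul_pos (Nat.succ_pos _) (Nat.succ_pos _)

/-- Because ρ ≤ 1, the factor ρ^((j+1)(k+1)) cancels the growth ρ^(-(k+1)) of c_{k+1} for every j,
leaving the double sum already estimated. The free exponent s allows a sharp choice for D and a
wasteful one for the factors. -/
theorem exists_clusterMoment_le (hρ : 0 < ρ) (hρ1 : ρ ≤ 1) (hc0 : ∀ k : ℕ, 1 ≤ k → 0 ≤ c k)
    (hK : 0 < K) (hcK : ∀ k : ℕ, c (k + 1) ≤ K * ((k : ℝ) + 1) ^ (α - 1) * (ρ ^ (k + 1))⁻¹)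
    (hv0 : ∀ j, 0 ≤ v j) (hv : ∀ j : ℕ, v j ≤ ((j : ℝ) + 1) ^ q) (m : ℕ) {s : ℝ} (hs : 0 ≤ s)
    (h1 : α - 1 + m ≤ s) (h2 : q + m < s) :
    ∃ B : ℝ, 0 < B ∧ ∀ r : ℝ, 0 < r → r < ρ →
      Summable (fun i => clusterWeight c v i * (clusterDegree i : ℝ) ^ m * r ^ clusterDegree i) ∧
      degreeMoment (clusterWeight c v) clusterDegree m r ≤ B * Real.log (ρ / r) ^ (-s - 1) := by
  obtain ⟨B, hB, H⟩ := exists_tsum_prod_rpow_mul_exp_le hs h2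
  refine ⟨K * B, by positivity, fun r hr hrρ => ?_⟩
  have hχ0 := log_div_pos hr hrρ
  have hrexp := mul_exp_neg_log_div hρ hr
  set χ := Real.log (ρ / r) with hχ
  obtain ⟨H1, H2⟩ := H χ hχ0
  have hle : ∀ i : ℕ × ℕ,
      clusterWeight c v i * (clusterDegree i : ℝ) ^ m * r ^ clusterDegree i
        ≤ K * (((i.1 : ℝ) + 1) ^ (q + m) * (((i.2 : ℝ) + 1) ^ s
          * Real.exp (-(((i.2 : ℝ) + 1) * (((i.1 : ℝ) + 1) * χ))))) := by
    rintro ⟨j, k⟩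
    have e1 : r ^ clusterDegree (j, k) = ρ ^ ((j + 1) * (k + 1))
        * Real.exp (-(((k : ℝ) + 1) * (((j : ℝ) + 1) * χ))) := by
      rw [← hrexp, mul_pow, ← Real.exp_nat_mul, clusterDegree]
      congr 2
      push_cast
      ring
    have e2 : (ρ ^ (k + 1))⁻¹ * ρ ^ ((j + 1) * (k + 1)) ≤ 1 := by
      rw [inv_mul_le_one₀ (by positivity)]
      exact pow_le_pow_of_le_one hρ.le hρ1 (Nat.le_mul_of_pos_left _ (Nat.succ_pos j))
    have e3 : ((k : ℝ) + 1) ^ (α - 1) * ((k : ℝ) + 1) ^ m ≤ ((k : ℝ) + 1) ^ s := by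
      rw [← Real.rpow_natCast, ← Real.rpow_add (by positivity)]
      exact Real.rpow_le_rpow_of_exponent_le (by linarith [k.cast_nonneg (α := ℝ)]) h1
    have e4 : ((j : ℝ) + 1) ^ (q + m) = ((j : ℝ) + 1) ^ q * ((j : ℝ) + 1) ^ m := by
      rw [Real.rpow_add (by positivity), Real.rpow_natCast]
    have hck := hc0 (k + 1) (by omega)
    simp only [clusterWeight]
    rw [e1, e4, clusterDegree]
    push_cast
    rw [mul_pow]
    calc v j * c (k + 1) * (((j : ℝ) + 1) ^ m * ((k : ℝ) + 1) ^ m) * (ρ ^ ((j + 1) * (k + 1))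
          * Real.exp (-(((k : ℝ) + 1) * (((j : ℝ) + 1) * χ))))
        ≤ ((j : ℝ) + 1) ^ q * (K * ((k : ℝ) + 1) ^ (α - 1) * (ρ ^ (k + 1))⁻¹)
          * (((j : ℝ) + 1) ^ m * ((k : ℝ) + 1) ^ m) * (ρ ^ ((j + 1) * (k + 1))
          * Real.exp (-(((k : ℝ) + 1) * (((j : ℝ) + 1) * χ)))) := by
          gcongr
          · exact hv j
          · exact hcK k
      _ = K * (((j : ℝ) + 1) ^ q * ((j : ℝ) + 1) ^ m
          * ((((k : ℝ) + 1) ^ (α - 1) * ((k : ℝ) + 1) ^ m)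
          * Real.exp (-(((k : ℝ) + 1) * (((j : ℝ) + 1) * χ)))))
          * ((ρ ^ (k + 1))⁻¹ * ρ ^ ((j + 1) * (k + 1))) := by ring
      _ ≤ K * (((j : ℝ) + 1) ^ q * ((j : ℝ) + 1) ^ m
          * (((k : ℝ) + 1) ^ s * Real.exp (-(((k : ℝ) + 1) * (((j : ℝ) + 1) * χ))))) * 1 := by
          gcongr
      _ = _ := mul_one _
  have hnn : ∀ i : ℕ × ℕ,
      0 ≤ clusterWeight c v i * (clusterDegree i : ℝ) ^ m * r ^ clusterDegree i := fun i =>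
    mul_nonneg (mul_nonneg (clusterWeight_nonneg hc0 hv0 i) (by positivity)) (by positivity)
  have hsum := (H1.mul_left K).of_nonneg_of_le hnn hle
  refine ⟨hsum, (hsum.tsum_le_tsum hle (H1.mul_left K)).trans ?_⟩
  rw [tsum_mul_left, mul_assoc]
  exact mul_le_mul_of_nonneg_left H2 hK.le

theorem exists_clusterMoment_le_rpow (hρ : 0 < ρ) (hρ1 : ρ ≤ 1)
    (hc0 : ∀ k : ℕ, 1 ≤ k → 0 ≤ c k) (hK : 0 < K)
    (hcK : ∀ k : ℕ, c (k + 1) ≤ K * ((k : ℝ) + 1) ^ (α - 1) * (ρ ^ (k + 1))⁻¹)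
    (hv0 : ∀ j, 0 ≤ v j) (hv : ∀ j : ℕ, v j ≤ ((j : ℝ) + 1) ^ q) (m : ℕ) :
    ∃ B M : ℝ, 0 < B ∧ ∀ r : ℝ, 0 < r → r < ρ →
      Summable (fun i => clusterWeight c v i * (clusterDegree i : ℝ) ^ m * r ^ clusterDegree i) ∧
      degreeMoment (clusterWeight c v) clusterDegree m r ≤ B * Real.log (ρ / r) ^ (-M) := by
  have h0 : (0 : ℝ) ≤ m := m.cast_nonneg
  obtain ⟨B, hB, H⟩ := exists_clusterMoment_le hρ hρ1 hc0 hK hcK hv0 hv m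
    (s := |α - 1| + |q| + m + 1) (by positivity)
    (by linarith [le_abs_self (α - 1), abs_nonneg q])
    (by linarith [le_abs_self q, abs_nonneg (α - 1)])
  refine ⟨B, |α - 1| + |q| + m + 1 + 1, hB, fun r hr hrρ => ?_⟩
  rw [neg_add (_ + 1) (1 : ℝ), ← sub_eq_add_neg]
  exact H r hr hrρ

theorem isDegreeSeries_cluster (hρ : 0 < ρ) (hρ1 : ρ ≤ 1)
    (hc0 : ∀ k : ℕ, 1 ≤ k → 0 ≤ c k) (hK : 0 < K)
    (hcK : ∀ k : ℕ, c (k + 1) ≤ K * ((k : ℝ) + 1) ^ (α - 1) * (ρ ^ (k + 1))⁻¹)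
    (hv0 : ∀ j, 0 ≤ v j) (hv : ∀ j : ℕ, v j ≤ ((j : ℝ) + 1) ^ q) :
    IsDegreeSeries (clusterWeight c v) clusterDegree ρ where
  nonneg := clusterWeight_nonneg hc0 hv0
  deg_pos := clusterDegree_pos
  summable k r hr hrρ := by
    obtain ⟨B, M, -, H⟩ := exists_clusterMoment_le_rpow hρ hρ1 hc0 hK hcK hv0 hv k
    rcases hr.eq_or_lt with rfl | hr
    · refine summable_zero.congr fun i => ?_
      rw [zero_pow (by have := clusterDegree_pos i; omega), mul_zero]
    · exact (H r hr hrρ).1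

theorem tsum_mul_clusterSeries (h : IsDegreeSeries (clusterWeight c v) clusterDegree ρ) {x : ℂ}
    (hx : ‖x‖ < ρ) :
    ∑' j : ℕ, (v j : ℂ) * clusterSeries c (x ^ (j + 1))
      = degreeSeries (clusterWeight c v) clusterDegree x := by
  rw [degreeSeries, (h.summable_norm hx).of_norm.tsum_prod]
  refine tsum_congr fun j => ?_
  rw [clusterSeries, ← tsum_mul_left]
  refine tsum_congr fun k => ?_
  simp only [clusterWeight, clusterDegree]
  rw [pow_mul]
  push_cast
  ring

/-- Every term of ∑ w r^d (1 - cos dθ) is non-negative, so it may be cut down to the row j = 0,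
which is C itself because v_0 = 1. -/
theorem exists_le_clusterMoment_sub_re {A β : ℝ} (hA : 0 < A) (hβ : 0 < β) (hρ : 0 < ρ)
    (hcA : ∀ᶠ n : ℕ in atTop, A * (n : ℝ) ^ (β - 1) * ρ ^ (-(n : ℤ)) ≤ c n)
    (h : IsDegreeSeries (clusterWeight c v) clusterDegree ρ) (hv1 : v 0 = 1) :
    ∃ a χ₀ : ℝ, 0 < a ∧ 0 < χ₀ ∧ ∀ r : ℝ, 0 < r → r < ρ → Real.log (ρ / r) ≤ χ₀ →
      ∀ θ : ℝ, |θ| ≤ Real.pi →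
      a * Real.log (ρ / r) ^ (-β) * min 1 ((θ / Real.log (ρ / r)) ^ 2)
        ≤ degreeMoment (clusterWeight c v) clusterDegree 0 r
          - (degreeSeries (clusterWeight c v) clusterDegree
            ((r : ℂ) * Complex.exp (Complex.I * (θ : ℂ)))).re := by
  obtain ⟨a, χ₀, ha, hχ₀, H⟩ := exists_le_sum_mul_one_sub_cos hA hβ hρ hcA
  refine ⟨a, χ₀, ha, hχ₀, fun r hr hrρ hχ θ hθ => ?_⟩
  obtain ⟨N, hN, HN⟩ := H r hr hrρ hχ
  refine (HN θ hθ).trans ?_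
  have hsum := h.hasSum_moment_sub_re hr.le hrρ θ
  -- The pair (0, n - 1) has degree n and weight c_n; truncated subtraction is harmless because n ≥
  -- N ≥ 1.
  have hinj : Set.InjOn (fun n : ℕ => ((0, n - 1) : ℕ × ℕ)) (Finset.Icc N (3 * N)) := by
    intro x hx y hy hxy
    simp only [Finset.coe_Icc, Set.mem_Icc, Prod.mk.injEq, true_and] at hx hy hxy
    omega
  refine le_trans (le_of_eq ?_) (sum_le_hasSum ((Finset.Icc N (3 * N)).image
    fun n : ℕ => ((0, n - 1) : ℕ × ℕ)) (fun i _ => ?_) hsum)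
  · rw [Finset.sum_image hinj]
    refine Finset.sum_congr rfl fun n hn => ?_
    have hn1 : n - 1 + 1 = n := by
      rw [Finset.mem_Icc] at hn
      omega
    simp [clusterWeight, clusterDegree, hv1, hn1]
  · have := h.nonneg i
    have := Real.cos_le_one (clusterDegree i * θ)
    exact mul_nonneg (by positivity) (by linarith)

end

/-! ### Consequences of a cosine gap and polynomial moments. -/

/-- All moments grow at most polynomially in `1 / log (ρ / r)`. -/
def HasPolynomialMoments {ι : Type*} (w : ι → ℝ) (d : ι → ℕ) (ρ : ℝ) : Prop :=
  ∀ k : ℕ, ∃ B M : ℝ, 0 < B ∧ ∀ r : ℝ, 0 < r → r < ρ →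
    degreeMoment w d k r ≤ B * Real.log (ρ / r) ^ (-M)

/-- Quantitative loss of the real part of a degree series off the positive real axis. -/
def HasCosineGap {ι : Type*} (w : ι → ℝ) (d : ι → ℕ) (ρ β : ℝ) : Prop :=
  ∃ a χ₀ : ℝ, 0 < a ∧ 0 < χ₀ ∧ ∀ r : ℝ, 0 < r → r < ρ → Real.log (ρ / r) ≤ χ₀ →
    ∀ θ : ℝ, |θ| ≤ Real.pi →
    a * Real.log (ρ / r) ^ (-β) * min 1 ((θ / Real.log (ρ / r)) ^ 2)
      ≤ degreeMoment w d 0 r - (degreeSeries w d ((r : ℂ) * Complex.exp (Complex.I * (θ : ℂ)))).re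

theorem tendsto_log_div_nhdsLT {ρ : ℝ} (hρ : 0 < ρ) :
    Tendsto (fun r => Real.log (ρ / r)) (𝓝[<] ρ) (𝓝[>] 0) := by
  refine tendsto_nhdsWithin_iff.2 ⟨?_, ?_⟩
  · have h : ContinuousAt (fun r => Real.log (ρ / r)) ρ :=
      (continuousAt_const.div continuousAt_id hρ.ne').log (by simp [hρ.ne'])
    have := h.tendsto
    simp only [div_self hρ.ne', Real.log_one] at this
    exact this.mono_left nhdsWithin_le_nhds
  · filter_upwards [Ioo_mem_nhdsLT hρ] with r hr using log_div_pos hr.1 hr.2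

theorem tendsto_rpow_nhdsGT_zero {p : ℝ} (hp : 0 < p) :
    Tendsto (fun x : ℝ => x ^ p) (𝓝[>] 0) (𝓝 0) := by
  have h := (Real.continuousAt_rpow_const 0 p (Or.inr hp.le)).tendsto
  rw [Real.zero_rpow hp.ne'] at h
  exact h.mono_left nhdsWithin_le_nhds

theorem tendsto_rpow_mul_exp_neg_mul_rpow_nhdsGT_zero (p : ℝ) {b κ : ℝ} (hb : 0 < b)
    (hκ : 0 < κ) :
    Tendsto (fun x : ℝ => x ^ p * Real.exp (-b * x ^ (-κ))) (𝓝[>] 0) (𝓝 0) := by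
  have h := (tendsto_rpow_mul_exp_neg_mul_atTop_nhds_zero (-p / κ) b hb).comp
    (tendsto_rpow_neg_nhdsGT_zero (y := -κ) (by linarith))
  refine h.congr' ?_
  filter_upwards [self_mem_nhdsWithin] with x (hx : 0 < x)
  simp only [Function.comp]
  rw [← Real.rpow_mul hx.le]
  congr 2
  field_simp

section

variable {ι : Type*} {w : ι → ℝ} {d : ι → ℕ} {ρ β : ℝ}

/-- Take θ = 1: once χ ≤ 1 the minimum is 1, and the loss of real part is at most twice the mass, so
the mass is at least (a/2) χ^(-β). -/
theorem HasCosineGap.tendsto_moment_zero (hgap : HasCosineGap w d ρ β)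
    (h : IsDegreeSeries w d ρ) (hρ : 0 < ρ) (hβ : 0 < β) :
    Tendsto (degreeMoment w d 0) (𝓝[<] ρ) atTop := by
  obtain ⟨a, χ₀, ha, hχ₀, H⟩ := hgap
  have h1 : Tendsto (fun r => a / 2 * Real.log (ρ / r) ^ (-β)) (𝓝[<] ρ) atTop :=
    ((tendsto_rpow_neg_nhdsGT_zero (by linarith)).comp (tendsto_log_div_nhdsLT hρ)).const_mul_atTop
      (by positivity)
  refine tendsto_atTop_mono' _ ?_ h1
  filter_upwards [Ioo_mem_nhdsLT hρ,
    (tendsto_log_div_nhdsLT hρ).eventually (Ioo_mem_nhdsGT (lt_min hχ₀ one_pos))] with r hr hχ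
  have hχ1 := hχ.2.le.trans (min_le_right _ _)
  have h2 := H r hr.1 hr.2 (hχ.2.le.trans (min_le_left _ _)) 1
    (by rw [abs_one]; linarith [Real.pi_gt_three])
  rw [min_eq_left, mul_one] at h2
  · have h3 := h.norm_series_le (x := (r : ℂ) * Complex.exp (Complex.I * ((1 : ℝ) : ℂ)))
      (by rw [IsDegreeSeries.norm_polar hr.1.le]; exact hr.2)
    rw [IsDegreeSeries.norm_polar hr.1.le] at h3
    have h4 := (abs_le.1 ((Complex.abs_re_le_norm _).trans h3)).1
    linarith
  · exact one_le_pow₀ ((one_le_div hχ.1).2 hχ1)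

/-- The moments relative to the total mass are `o(χ ^ (-k (1 + δ)))`, where `χ = log (ρ / r)`. -/
theorem tendsto_thetaCut_pow_mul_moment_div (h : IsDegreeSeries w d ρ) (hρ : 0 < ρ) (hβ : 0 < β)
    (hgap : HasCosineGap w d ρ β) (hpoly : HasPolynomialMoments w d ρ) {δ : ℝ} (hδ : 0 < δ)
    {k : ℕ} (hk : k ≠ 0) :
    Tendsto (fun r => thetaCut ρ δ r ^ k * (degreeMoment w d k r / degreeMoment w d 0 r))
      (𝓝[<] ρ) (𝓝 0) := by
  obtain ⟨B, M, hB, hM⟩ := hpoly k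
  have hlog := tendsto_log_div_nhdsLT hρ
  have hlim : Tendsto (fun x : ℝ => (x ^ (δ / 2)) ^ k + B * 2 ^ M * (x ^ ((1 + δ) * k - M)
      * Real.exp (-(1 / 2) * x ^ (-(δ / 2))))) (𝓝[>] 0) (𝓝 0) := by
    have h1 := ((tendsto_rpow_nhdsGT_zero (show 0 < δ / 2 by linarith)).pow k).add
      ((tendsto_rpow_mul_exp_neg_mul_rpow_nhdsGT_zero ((1 + δ) * k - M)
        (show (0 : ℝ) < 1 / 2 by norm_num) (show 0 < δ / 2 by linarith)).const_mul (B * 2 ^ M))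
    simpa [hk] using h1
  have hmass := hgap.tendsto_moment_zero h hρ hβ
  refine squeeze_zero' ?_ ?_ (hlim.comp hlog)
  · filter_upwards [Ioo_mem_nhdsLT hρ] with r hr
    have := log_div_pos hr.1 hr.2
    have := h.moment_nonneg k hr.1.le
    have := h.moment_nonneg 0 hr.1.le
    rw [thetaCut]
    positivity
  · filter_upwards [Ioo_mem_nhdsLT hρ, hmass.eventually_ge_atTop 1] with r hr hm
    have hχ := log_div_pos hr.1 hr.2
    have hr0 := hr.1
    have hrexp := mul_exp_neg_log_div hρ hr.1
    simp only [Function.comp, thetaCut]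
    set χ := Real.log (ρ / r) with hχdef
    set m₀ := degreeMoment w d 0 r
    have hr' : r * Real.exp (χ / 2) = ρ * Real.exp (-(χ / 2)) := by
      rw [← hrexp, mul_assoc, ← Real.exp_add]
      congr 2
      ring
    have hr'ρ : r * Real.exp (χ / 2) < ρ := by
      rw [hr']
      exact mul_lt_of_lt_one_right hρ (Real.exp_lt_one_iff.2 (by linarith))
    have hlog' : Real.log (ρ / (r * Real.exp (χ / 2))) = χ / 2 := by
      rw [hr', div_mul_cancel_left₀ hρ.ne', Real.log_inv, Real.log_exp]
      ring
    have hN : (0 : ℝ) ≤ χ ^ (-1 - δ / 2) := by positivity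
    -- The cutoff χ^(-1-δ/2) lies below χ^(-1-δ), so low degrees contribute a factor χ^(kδ/2) → 0.
    -- Moving to radius r e^(χ/2), where log(ρ/·) is χ/2, costs only a polynomial factor and yields
    -- exp(-χ^(-δ/2)/2) for the high degrees.
    have hsplit := h.moment_le_split k hr0.le (by positivity : 0 ≤ χ / 2) hN hr'ρ
    have hM' := hM (r * Real.exp (χ / 2)) (by positivity) hr'ρ
    rw [hlog'] at hM'
    have e1 : (χ ^ (1 + δ)) ^ k * (χ ^ (-1 - δ / 2)) ^ k = (χ ^ (δ / 2)) ^ k := by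
      rw [← mul_pow, ← Real.rpow_add hχ]
      congr 2
      ring
    have e2 : χ ^ (-1 - δ / 2) * (χ / 2) = 1 / 2 * χ ^ (-(δ / 2)) := by
      rw [show -(δ / 2) = (-1 - δ / 2) + 1 by ring, Real.rpow_add hχ, Real.rpow_one]
      ring
    have e3 : (χ ^ (1 + δ)) ^ k * (χ / 2) ^ (-M) = 2 ^ M * χ ^ ((1 + δ) * k - M) := by
      rw [Real.div_rpow hχ.le two_pos.le, Real.rpow_neg two_pos.le, sub_eq_add_neg,
        Real.rpow_add hχ ((1 + δ) * k) (-M), Real.rpow_mul hχ.le, Real.rpow_natCast]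
      field_simp
    have hm0 : 0 < m₀ := by linarith
    rw [e2] at hsplit
    have hdiv : degreeMoment w d k r / m₀ ≤ (χ ^ (-1 - δ / 2)) ^ k
        + Real.exp (-(1 / 2 * χ ^ (-(δ / 2)))) * (B * (χ / 2) ^ (-M)) := by
      rw [div_le_iff₀ hm0, add_mul]
      refine hsplit.trans (add_le_add le_rfl ?_)
      have hpos : 0 ≤ Real.exp (-(1 / 2 * χ ^ (-(δ / 2)))) * (B * (χ / 2) ^ (-M)) := by positivity
      exact (mul_le_mul_of_nonneg_left hM' (Real.exp_pos _).le).trans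
        (le_mul_of_one_le_right hpos hm)
    calc (χ ^ (1 + δ)) ^ k * (degreeMoment w d k r / m₀)
        ≤ (χ ^ (1 + δ)) ^ k * ((χ ^ (-1 - δ / 2)) ^ k
          + Real.exp (-(1 / 2 * χ ^ (-(δ / 2)))) * (B * (χ / 2) ^ (-M))) := by gcongr
      _ = (χ ^ (1 + δ)) ^ k * (χ ^ (-1 - δ / 2)) ^ k + B * ((χ ^ (1 + δ)) ^ k * (χ / 2) ^ (-M))
          * Real.exp (-(1 / 2 * χ ^ (-(δ / 2)))) := by ring
      _ = _ := by
          rw [e1, e3, neg_mul]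
          ring

end

/-! ### Power series and radius of convergence. -/

/-- By uniqueness of expansions at 0, the Cauchy series of one fixed smaller circle serves every
radius below ρ. -/
theorem exists_hasFPowerSeriesOnBall_of_differentiableOn_ball {F : ℂ → ℂ} {ρ : ℝ} (hρ : 0 < ρ)
    (hF : DifferentiableOn ℂ F (Metric.ball 0 ρ)) :
    ∃ P : FormalMultilinearSeries ℂ ℂ ℂ, HasFPowerSeriesOnBall F P 0 (ENNReal.ofReal ρ) := by
  have hball : ∀ R : NNReal, 0 < R → (R : ℝ) < ρ →
      HasFPowerSeriesOnBall F (cauchyPowerSeries F 0 R) 0 R := fun R hR hRρ =>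
    (hF.mono (Metric.closedBall_subset_ball hRρ)).hasFPowerSeriesOnBall hR
  obtain ⟨R₀, hR₀, hR₀ρ⟩ := exists_between hρ
  lift R₀ to NNReal using hR₀.le
  have heq : ∀ R : NNReal, 0 < R → (R : ℝ) < ρ →
      HasFPowerSeriesOnBall F (cauchyPowerSeries F 0 R₀) 0 R := fun R hR hRρ => by
    rw [(hball R₀ (by exact_mod_cast hR₀) hR₀ρ).hasFPowerSeriesAt.eq_formalMultilinearSeries
      (hball R hR hRρ).hasFPowerSeriesAt]
    exact hball R hR hRρ
  refine ⟨cauchyPowerSeries F 0 R₀, ?_, by simpa using hρ, ?_⟩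
  · refine ENNReal.le_of_forall_nnreal_lt fun R hR => ?_
    have hRρ : (R : ℝ) < ρ := by
      rw [← ENNReal.ofReal_coe_nnreal] at hR
      exact (ENNReal.ofReal_lt_ofReal_iff hρ).1 hR
    rcases eq_zero_or_pos R with rfl | hR0
    · simp
    · exact (heq R hR0 hRρ).r_le
  · intro y hy
    rw [Metric.eball_ofReal, mem_ball_zero_iff] at hy
    obtain ⟨R, hyR, hRρ⟩ := exists_between hy
    have hR0 : 0 < R := (norm_nonneg y).trans_lt hyR
    lift R to NNReal using hR0.le
    refine (heq R (by exact_mod_cast hR0) hRρ).hasSum ?_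
    rw [Metric.eball_coe, mem_ball_zero_iff]
    exact hyR

/-- A function that blows up at `ρ` along the real axis cannot have a larger radius of
convergence. -/
theorem radius_eq_of_tendsto_norm_atTop {F : ℂ → ℂ} {ρ : ℝ} (hρ : 0 < ρ)
    {P : FormalMultilinearSeries ℂ ℂ ℂ} (hP : HasFPowerSeriesOnBall F P 0 (ENNReal.ofReal ρ))
    (hF : Tendsto (fun r : ℝ => ‖F (r : ℂ)‖) (𝓝[<] ρ) atTop) :
    P.radius = ENNReal.ofReal ρ := by
  refine le_antisymm (le_of_not_gt fun hlt => ?_) hP.r_le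
  have hmem : (ρ : ℂ) ∈ Metric.eball (0 : ℂ) P.radius := by
    rw [mem_eball_zero_iff, ← ofReal_norm, Complex.norm_real, Real.norm_of_nonneg hρ.le]
    exact hlt
  have hcont : ContinuousAt P.sum (ρ : ℂ) :=
    P.continuousOn.continuousAt (Metric.isOpen_eball.mem_nhds hmem)
  have h1 : Tendsto (fun r : ℝ => ‖P.sum (r : ℂ)‖) (𝓝[<] ρ) (𝓝 ‖P.sum (ρ : ℂ)‖) :=
    ((hcont.tendsto.comp Complex.continuous_ofReal.continuousAt.tendsto).norm).mono_left
      nhdsWithin_le_nhds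
  refine not_tendsto_nhds_of_tendsto_atTop hF _ (h1.congr' ?_)
  filter_upwards [Ioo_mem_nhdsLT hρ] with r hr
  have hr' : (r : ℂ) ∈ Metric.eball (0 : ℂ) (ENNReal.ofReal ρ) := by
    rw [Metric.eball_ofReal, mem_ball_zero_iff, Complex.norm_real, Real.norm_of_nonneg hr.1.le]
    exact hr.2
  rw [← hP.sum hr', zero_add]

/-! ### Exponentials times products: Hayman's a and b, and exact factorisations. -/

/-- On the disc of radius `ρ`, `F` is the exponential of a degree series times finitely many
degree series that are positive on `(0, ρ)`. -/
structure IsExpMulProd {ι κ : Type*} [Fintype κ] (F : ℂ → ℂ) (w : ι → ℝ) (W : κ → ι → ℝ)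
    (d : ι → ℕ) (ρ : ℝ) : Prop where
  radius_pos : 0 < ρ
  main : IsDegreeSeries w d ρ
  factor : ∀ i, IsDegreeSeries (W i) d ρ
  factor_pos : ∀ i (r : ℝ), 0 < r → r < ρ → 0 < degreeMoment (W i) d 0 r
  eq : ∀ x : ℂ, ‖x‖ < ρ → F x = Complex.exp (degreeSeries w d x) * ∏ i, degreeSeries (W i) d x

/-- Mean of the degrees under the weights `w i * r ^ d i`. -/
noncomputable def degreeMean {ι : Type*} (w : ι → ℝ) (d : ι → ℕ) (r : ℝ) : ℝ :=
  degreeMoment w d 1 r / degreeMoment w d 0 r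

/-- Variance of the degrees under the weights `w i * r ^ d i`. -/
noncomputable def degreeVariance {ι : Type*} (w : ι → ℝ) (d : ι → ℕ) (r : ℝ) : ℝ :=
  degreeMoment w d 2 r / degreeMoment w d 0 r - degreeMean w d r ^ 2

theorem degreeVariance_le {ι : Type*} (w : ι → ℝ) (d : ι → ℕ) (r : ℝ) :
    degreeVariance w d r ≤ degreeMoment w d 2 r / degreeMoment w d 0 r :=
  sub_le_self _ (sq_nonneg _)

namespace IsExpMulProd

variable {ι κ : Type*} [Fintype κ] {F : ℂ → ℂ} {w : ι → ℝ} {W : κ → ι → ℝ} {d : ι → ℕ}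
  {ρ β δ : ℝ}

theorem mean_nonneg (h : IsExpMulProd F w W d ρ) (i : κ) {r : ℝ} (hr : 0 ≤ r) :
    0 ≤ degreeMean (W i) d r :=
  div_nonneg ((h.factor i).moment_nonneg 1 hr) ((h.factor i).moment_nonneg 0 hr)

theorem variance_nonneg (h : IsExpMulProd F w W d ρ) (i : κ) {r : ℝ} (hr : 0 < r) (hrρ : r < ρ) :
    0 ≤ degreeVariance (W i) d r :=
  sub_nonneg.2 ((h.factor i).moment_one_sq_le hr.le hrρ (h.factor_pos i r hr hrρ))

theorem apply_ofReal (h : IsExpMulProd F w W d ρ) {r : ℝ} (hr : 0 < r) (hrρ : r < ρ) :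
    F (r : ℂ) = ((Real.exp (degreeMoment w d 0 r) * ∏ i, degreeMoment (W i) d 0 r : ℝ) : ℂ) := by
  rw [h.eq _ (by rwa [Complex.norm_real, Real.norm_of_nonneg hr.le])]
  simp only [IsDegreeSeries.series_ofReal]
  push_cast
  rfl

theorem prod_pos (h : IsExpMulProd F w W d ρ) {r : ℝ} (hr : 0 < r) (hrρ : r < ρ) :
    0 < ∏ i, degreeMoment (W i) d 0 r :=
  Finset.prod_pos fun i _ => h.factor_pos i r hr hrρ

theorem haymanLog_eq (h : IsExpMulProd F w W d ρ) {r : ℝ} (hr : 0 < r) (hrρ : r < ρ) :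
    haymanLog F r = degreeMoment w d 0 r + ∑ i, Real.log (degreeMoment (W i) d 0 r) := by
  rw [haymanLog, h.apply_ofReal hr hrρ, Complex.ofReal_re,
    Real.log_mul (Real.exp_pos _).ne' (h.prod_pos hr hrρ).ne', Real.log_exp,
    Real.log_prod fun i _ => (h.factor_pos i r hr hrρ).ne']

theorem hasDerivAt_haymanLog (h : IsExpMulProd F w W d ρ) {r : ℝ} (hr : 0 < r) (hrρ : r < ρ) :
    HasDerivAt (haymanLog F) ((degreeMoment w d 1 r + ∑ i, degreeMean (W i) d r) / r) r := by
  have h1 := (h.main.hasDerivAt_moment 0 hr hrρ).add (HasDerivAt.fun_sum (u := Finset.univ)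
    fun i _ => ((h.factor i).hasDerivAt_moment 0 hr hrρ).log (h.factor_pos i r hr hrρ).ne')
  refine (h1.congr_of_eventuallyEq ?_).congr_deriv ?_
  · filter_upwards [Ioo_mem_nhds hr hrρ] with x hx using h.haymanLog_eq hx.1 hx.2
  · rw [add_div, Finset.sum_div]
    congr 1
    refine Finset.sum_congr rfl fun i _ => ?_
    rw [degreeMean, div_right_comm]

theorem haymanA_eq (h : IsExpMulProd F w W d ρ) {r : ℝ} (hr : 0 < r) (hrρ : r < ρ) :
    haymanA F r = degreeMoment w d 1 r + ∑ i, degreeMean (W i) d r := by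
  rw [haymanA, (h.hasDerivAt_haymanLog hr hrρ).deriv]
  field_simp

theorem haymanB_eq (h : IsExpMulProd F w W d ρ) {r : ℝ} (hr : 0 < r) (hrρ : r < ρ) :
    haymanB F r = degreeMoment w d 2 r + ∑ i, degreeVariance (W i) d r := by
  have h1 := (h.main.hasDerivAt_moment 1 hr hrρ).add (HasDerivAt.fun_sum (u := Finset.univ)
    fun i _ => ((h.factor i).hasDerivAt_moment 1 hr hrρ).div
      ((h.factor i).hasDerivAt_moment 0 hr hrρ) (h.factor_pos i r hr hrρ).ne')
  have h2 := (h1.div (hasDerivAt_id r) hr.ne').congr_of_eventuallyEq (f₁ := deriv (haymanLog F)) (by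
    filter_upwards [Ioo_mem_nhds hr hrρ] with x hx
    exact (h.hasDerivAt_haymanLog hx.1 hx.2).deriv)
  rw [haymanB, h2.deriv, (h.hasDerivAt_haymanLog hr hrρ).deriv]
  have h3 : ∑ i, (degreeMoment (W i) d (1 + 1) r / r * degreeMoment (W i) d 0 r
      - degreeMoment (W i) d 1 r * (degreeMoment (W i) d (0 + 1) r / r))
        / degreeMoment (W i) d 0 r ^ 2 = (∑ i, degreeVariance (W i) d r) / r := by
    rw [Finset.sum_div]
    refine Finset.sum_congr rfl fun i _ => ?_
    have := (h.factor_pos i r hr hrρ).ne'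
    rw [degreeVariance, degreeMean]
    field_simp
  rw [h3]
  simp only [Pi.add_apply, Pi.div_apply, id_eq, degreeMean]
  field_simp
  ring

theorem differentiableOn (h : IsExpMulProd F w W d ρ) :
    DifferentiableOn ℂ F (Metric.ball 0 ρ) := by
  have h1 : DifferentiableOn ℂ (fun x => Complex.exp (degreeSeries w d x)
      * ∏ i, degreeSeries (W i) d x) (Metric.ball 0 ρ) :=
    h.main.differentiableOn_series.cexp.mul
      (DifferentiableOn.fun_finsetProd fun i _ => (h.factor i).differentiableOn_series)
  exact h1.congr fun x hx => h.eq x (by simpa using hx)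

theorem tendsto_norm_atTop (h : IsExpMulProd F w W d ρ)
    (hmain : Tendsto (degreeMoment w d 0) (𝓝[<] ρ) atTop)
    (hfac : ∀ i, Tendsto (degreeMoment (W i) d 0) (𝓝[<] ρ) atTop) :
    Tendsto (fun r : ℝ => ‖F (r : ℂ)‖) (𝓝[<] ρ) atTop := by
  refine tendsto_atTop_mono' _ ?_ hmain
  filter_upwards [Ioo_mem_nhdsLT h.radius_pos,
    eventually_all.2 fun i => (hfac i).eventually_ge_atTop 1] with r hr hge
  have h1 : 1 ≤ ∏ i, degreeMoment (W i) d 0 r := Finset.one_le_prod fun i _ => hge i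
  rw [h.apply_ofReal hr.1 hr.2, Complex.norm_real, Real.norm_of_nonneg
    (mul_pos (Real.exp_pos _) (h.prod_pos hr.1 hr.2)).le]
  have h2 := Real.add_one_le_exp (degreeMoment w d 0 r)
  nlinarith [Real.exp_pos (degreeMoment w d 0 r)]

/-- Since a and b are additive over the factors, the quotient splits exactly into one error for the
exponent and one for each W_i, to be estimated separately. -/
theorem div_gaussian_eq (h : IsExpMulProd F w W d ρ) {r : ℝ} (hr : 0 < r) (hrρ : r < ρ) (θ : ℝ) :
    F ((r : ℂ) * Complex.exp (Complex.I * (θ : ℂ))) /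
        (F (r : ℂ) * Complex.exp
          (Complex.I * (θ : ℂ) * (haymanA F r : ℂ) - (θ : ℂ) ^ 2 / 2 * (haymanB F r : ℂ)))
      = Complex.exp (degreeSeries w d ((r : ℂ) * Complex.exp (Complex.I * (θ : ℂ)))
          - ((degreeMoment w d 0 r : ℂ) + Complex.I * θ * (degreeMoment w d 1 r : ℂ)
          - (θ : ℂ) ^ 2 / 2 * (degreeMoment w d 2 r : ℂ)))
        * ∏ i, (degreeSeries (W i) d ((r : ℂ) * Complex.exp (Complex.I * (θ : ℂ)))
            / (degreeMoment (W i) d 0 r : ℂ)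
          * Complex.exp (-(Complex.I * θ * (degreeMean (W i) d r : ℂ)
            - (θ : ℂ) ^ 2 / 2 * (degreeVariance (W i) d r : ℂ)))) := by
  rw [h.eq _ (by rwa [IsDegreeSeries.norm_polar hr.le]), h.apply_ofReal hr hrρ,
    h.haymanA_eq hr hrρ, h.haymanB_eq hr hrρ, Finset.prod_mul_distrib, Finset.prod_div_distrib,
    ← Complex.exp_sum, Finset.sum_neg_distrib, Finset.sum_sub_distrib, ← Finset.mul_sum,
    ← Finset.mul_sum]
  have hp : ∏ i, (degreeMoment (W i) d 0 r : ℂ) ≠ 0 :=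
    Finset.prod_ne_zero_iff.2 fun i _ => Complex.ofReal_ne_zero.2 (h.factor_pos i r hr hrρ).ne'
  push_cast
  rw [div_eq_iff (mul_ne_zero (mul_ne_zero (Complex.exp_ne_zero _) hp) (Complex.exp_ne_zero _))]
  set S := degreeSeries w d ((r : ℂ) * Complex.exp (Complex.I * (θ : ℂ)))
  set Q := ∏ i, degreeSeries (W i) d ((r : ℂ) * Complex.exp (Complex.I * (θ : ℂ)))
  set P := ∏ i, (degreeMoment (W i) d 0 r : ℂ)
  set D0 := (degreeMoment w d 0 r : ℂ)
  set D1 := (degreeMoment w d 1 r : ℂ)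
  set D2 := (degreeMoment w d 2 r : ℂ)
  set A := ∑ i, (degreeMean (W i) d r : ℂ)
  set B := ∑ i, (degreeVariance (W i) d r : ℂ)
  have e : Complex.exp S = Complex.exp (S - (D0 + Complex.I * θ * D1 - θ ^ 2 / 2 * D2))
      * Complex.exp (-(Complex.I * θ * A - θ ^ 2 / 2 * B)) * Complex.exp D0
      * Complex.exp (Complex.I * θ * (D1 + A) - θ ^ 2 / 2 * (D2 + B)) := by
    rw [← Complex.exp_add, ← Complex.exp_add, ← Complex.exp_add]
    congr 1
    ring
  rw [e]
  field_simp

/-- Non-negative coefficients give |W_i(re^{iθ})| ≤ W_i(r), so only the exponent matters for decay.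
-/
theorem norm_le_exp_mul (h : IsExpMulProd F w W d ρ) {r : ℝ} (hr : 0 < r) (hrρ : r < ρ) (θ : ℝ) :
    ‖F ((r : ℂ) * Complex.exp (Complex.I * (θ : ℂ)))‖
      ≤ Real.exp (-(degreeMoment w d 0 r
        - (degreeSeries w d ((r : ℂ) * Complex.exp (Complex.I * (θ : ℂ)))).re)) * ‖F (r : ℂ)‖ := by
  have hx : ‖(r : ℂ) * Complex.exp (Complex.I * (θ : ℂ))‖ = r := IsDegreeSeries.norm_polar hr.le θ
  have hxρ : ‖(r : ℂ) * Complex.exp (Complex.I * (θ : ℂ))‖ < ρ := by rwa [hx]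
  rw [h.eq _ hxρ, h.apply_ofReal hr hrρ, Complex.norm_real,
    Real.norm_of_nonneg (mul_pos (Real.exp_pos _) (h.prod_pos hr hrρ)).le, norm_mul,
    Complex.norm_exp, norm_prod, ← mul_assoc, ← Real.exp_add]
  ring_nf
  refine mul_le_mul_of_nonneg_left (Finset.prod_le_prod (fun i _ => norm_nonneg _) fun i _ => ?_)
    (Real.exp_pos _).le
  have := (h.factor i).norm_series_le hxρ
  rwa [hx] at this

end IsExpMulProd

/-! ### Capture, locality and decay. -/

namespace IsExpMulProd

variable {ι κ : Type*} [Fintype κ] {F : ℂ → ℂ} {w : ι → ℝ} {W : κ → ι → ℝ} {d : ι → ℕ}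
  {α ρ β δ : ℝ}

theorem tendsto_haymanA (h : IsExpMulProd F w W d ρ)
    (hmain : Tendsto (degreeMoment w d 0) (𝓝[<] ρ) atTop) :
    Tendsto (haymanA F) (𝓝[<] ρ) atTop := by
  refine tendsto_atTop_mono' _ ?_ hmain
  filter_upwards [Ioo_mem_nhdsLT h.radius_pos] with r hr
  rw [h.haymanA_eq hr.1 hr.2]
  have h1 := h.main.moment_le_moment (Nat.zero_le 1) hr.1.le hr.2
  have h2 := Finset.sum_nonneg fun i (_ : i ∈ Finset.univ) => h.mean_nonneg i hr.1.le
  linarith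

theorem moment_zero_le_haymanB (h : IsExpMulProd F w W d ρ) {r : ℝ} (hr : 0 < r) (hrρ : r < ρ) :
    degreeMoment w d 0 r ≤ haymanB F r := by
  rw [h.haymanB_eq hr hrρ]
  have h1 := h.main.moment_le_moment (Nat.zero_le 2) hr.le hrρ
  have h2 := Finset.sum_nonneg fun i (_ : i ∈ Finset.univ) => h.variance_nonneg i hr hrρ
  linarith

theorem tendsto_haymanB (h : IsExpMulProd F w W d ρ)
    (hmain : Tendsto (degreeMoment w d 0) (𝓝[<] ρ) atTop) :
    Tendsto (haymanB F) (𝓝[<] ρ) atTop := by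
  refine tendsto_atTop_mono' _ ?_ hmain
  filter_upwards [Ioo_mem_nhdsLT h.radius_pos] with r hr using h.moment_zero_le_haymanB hr.1 hr.2

/-- `b(r)` grows at most polynomially in `1 / log (ρ / r)`. -/
theorem exists_haymanB_le (h : IsExpMulProd F w W d ρ) {B : ℝ}
    (hthird : ∀ r : ℝ, 0 < r → r < ρ → degreeMoment w d 3 r ≤ B * Real.log (ρ / r) ^ (-α - 3))
    (hα : 0 < α) (hδ : 0 < δ)
    (hratio : ∀ i, Tendsto (fun r => thetaCut ρ δ r ^ 2
      * (degreeMoment (W i) d 2 r / degreeMoment (W i) d 0 r)) (𝓝[<] ρ) (𝓝 0)) :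
    ∃ q : ℝ, ∀ᶠ r in 𝓝[<] ρ, haymanB F r ≤ Real.log (ρ / r) ^ (-q) := by
  have hlog := tendsto_log_div_nhdsLT h.radius_pos
  have hlim : Tendsto (fun r => B * Real.log (ρ / r) ^ (1 + (1 + δ) * 2)
      + Real.log (ρ / r) ^ (α + 4) * ∑ i, thetaCut ρ δ r ^ 2
        * (degreeMoment (W i) d 2 r / degreeMoment (W i) d 0 r)) (𝓝[<] ρ) (𝓝 0) := by
    have h1 := (((tendsto_rpow_nhdsGT_zero (show 0 < 1 + (1 + δ) * 2 by linarith)).comp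
      hlog).const_mul B).add (((tendsto_rpow_nhdsGT_zero (show 0 < α + 4 by linarith)).comp
      hlog).mul (tendsto_finsetSum Finset.univ fun i _ => hratio i))
    simpa using h1
  -- A generous exponent: multiplied by this power of χ, the bounds for both D_2 and the variances
  -- tend to 0, so their sum is eventually below 1.
  refine ⟨α + 4 + (1 + δ) * 2, ?_⟩
  filter_upwards [Ioo_mem_nhdsLT h.radius_pos, hlim.eventually (gt_mem_nhds one_pos)] with r hr hle
  have hχ := log_div_pos hr.1 hr.2
  rw [thetaCut, ← Finset.mul_sum] at hle
  have h3 := hthird r hr.1 hr.2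
  set χ := Real.log (ρ / r) with hχdef
  have e1 : χ ^ (α + 4 + (1 + δ) * 2) * χ ^ (-α - 3) = χ ^ (1 + (1 + δ) * 2) := by
    rw [← Real.rpow_add hχ]
    congr 1
    ring
  have e2 : χ ^ (α + 4 + (1 + δ) * 2) = χ ^ (α + 4) * (χ ^ (1 + δ)) ^ 2 := by
    rw [Real.rpow_add hχ, ← Real.rpow_natCast, ← Real.rpow_mul hχ.le]
    norm_num
  have h4 : haymanB F r ≤ B * χ ^ (-α - 3)
      + ∑ i, degreeMoment (W i) d 2 r / degreeMoment (W i) d 0 r := by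
    rw [h.haymanB_eq hr.1 hr.2]
    exact add_le_add ((h.main.moment_le_moment (by norm_num) hr.1.le hr.2).trans h3)
      (Finset.sum_le_sum fun i _ => degreeVariance_le (W i) d r)
  rw [Real.rpow_neg hχ.le, ← one_div, le_div_iff₀ (by positivity)]
  refine (mul_le_mul_of_nonneg_right h4 (by positivity)).trans (le_trans (le_of_eq ?_) hle.le)
  rw [← e1, add_mul]
  congr 1
  · ring
  · rw [e2]
    ring

theorem tendsto_div_gaussian (h : IsExpMulProd F w W d ρ) {B : ℝ}
    (hthird : ∀ r : ℝ, 0 < r → r < ρ → degreeMoment w d 3 r ≤ B * Real.log (ρ / r) ^ (-α - 3))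
    (hδ : α / 3 < δ)
    (hratio : ∀ i (k : ℕ), k ≠ 0 → Tendsto (fun r => thetaCut ρ δ r ^ k
      * (degreeMoment (W i) d k r / degreeMoment (W i) d 0 r)) (𝓝[<] ρ) (𝓝 0)) :
    Tendsto (fun p : ℝ × ℝ => F ((p.1 : ℂ) * Complex.exp (Complex.I * (p.2 : ℂ))) /
        (F (p.1 : ℂ) * Complex.exp (Complex.I * (p.2 : ℂ) * (haymanA F p.1 : ℂ)
          - (p.2 : ℂ) ^ 2 / 2 * (haymanB F p.1 : ℂ))))
      (comap Prod.fst (𝓝[<] ρ) ⊓ 𝓟 {p : ℝ × ℝ | |p.2| ≤ thetaCut ρ δ p.1}) (𝓝 1) := by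
  -- This filter on pairs (r, θ) encodes r → ρ⁻ uniformly in |θ| ≤ θ₀(r), so uniform estimates
  -- become ordinary limits.
  set L := comap Prod.fst (𝓝[<] ρ) ⊓ 𝓟 {p : ℝ × ℝ | |p.2| ≤ thetaCut ρ δ p.1} with hL
  have hfst : Tendsto Prod.fst L (𝓝[<] ρ) := tendsto_comap.mono_left inf_le_left
  have hmemr : ∀ᶠ p in L, p.1 ∈ Set.Ioo 0 ρ := hfst.eventually (Ioo_mem_nhdsLT h.radius_pos)
  have hmemθ : ∀ᶠ p in L, |p.2| ≤ thetaCut ρ δ p.1 := mem_inf_of_right (mem_principal_self _)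
  have hE : Tendsto (fun p : ℝ × ℝ =>
      degreeSeries w d ((p.1 : ℂ) * Complex.exp (Complex.I * (p.2 : ℂ)))
        - ((degreeMoment w d 0 p.1 : ℂ) + Complex.I * p.2 * (degreeMoment w d 1 p.1 : ℂ)
        - (p.2 : ℂ) ^ 2 / 2 * (degreeMoment w d 2 p.1 : ℂ))) L (𝓝 0) := by
    have hlim : Tendsto (fun r => 4 * B * Real.log (ρ / r) ^ (3 * δ - α)) (𝓝[<] ρ) (𝓝 0) := by
      have := ((tendsto_rpow_nhdsGT_zero (show 0 < 3 * δ - α by linarith)).comp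
        (tendsto_log_div_nhdsLT h.radius_pos)).const_mul (4 * B)
      simpa using this
    refine squeeze_zero_norm' ?_ (hlim.comp hfst)
    filter_upwards [hmemr, hmemθ] with p hr hθ
    have hχ := log_div_pos hr.1 hr.2
    refine (h.main.norm_series_sub_quadratic_le hr.1.le hr.2 p.2).trans ?_
    have hm := h.main.moment_nonneg 3 hr.1.le
    calc 4 * |p.2| ^ 3 * degreeMoment w d 3 p.1
        ≤ 4 * thetaCut ρ δ p.1 ^ 3 * (B * Real.log (ρ / p.1) ^ (-α - 3)) := by
          have hT : 0 ≤ thetaCut ρ δ p.1 := (abs_nonneg _).trans hθ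
          have h3 := hthird p.1 hr.1 hr.2
          gcongr
      _ = 4 * B * Real.log (ρ / p.1) ^ (3 * δ - α) := by
          rw [thetaCut, ← Real.rpow_natCast, ← Real.rpow_mul hχ.le,
            show 3 * δ - α = (1 + δ) * (3 : ℕ) + (-α - 3) by push_cast; ring, Real.rpow_add hχ]
          ring
  have hW : ∀ i, Tendsto (fun p : ℝ × ℝ =>
      degreeSeries (W i) d ((p.1 : ℂ) * Complex.exp (Complex.I * (p.2 : ℂ)))
        / (degreeMoment (W i) d 0 p.1 : ℂ)) L (𝓝 1) := by
    intro i
    rw [tendsto_iff_norm_sub_tendsto_zero]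
    refine squeeze_zero' (Eventually.of_forall fun p => norm_nonneg _) ?_
      ((hratio i 1 one_ne_zero).comp hfst)
    filter_upwards [hmemr, hmemθ] with p hr hθ
    have hm0 := h.factor_pos i p.1 hr.1 hr.2
    have hm0' : (degreeMoment (W i) d 0 p.1 : ℂ) ≠ 0 := Complex.ofReal_ne_zero.2 hm0.ne'
    have hm1 := (h.factor i).moment_nonneg 1 hr.1.le
    rw [div_sub_one hm0', norm_div, Complex.norm_real, Real.norm_of_nonneg hm0.le]
    simp only [Function.comp, pow_one]
    rw [← mul_div_assoc]
    gcongr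
    exact ((h.factor i).norm_series_sub_moment_le hr.1.le hr.2 p.2).trans (by gcongr)
  have hG : ∀ i, Tendsto (fun p : ℝ × ℝ => -(Complex.I * p.2 * (degreeMean (W i) d p.1 : ℂ)
      - (p.2 : ℂ) ^ 2 / 2 * (degreeVariance (W i) d p.1 : ℂ))) L (𝓝 0) := by
    intro i
    have hlim := ((hratio i 1 one_ne_zero).add (hratio i 2 two_ne_zero)).comp hfst
    rw [add_zero] at hlim
    refine squeeze_zero_norm' ?_ hlim
    filter_upwards [hmemr, hmemθ] with p hr hθ
    have hmean := h.mean_nonneg i hr.1.le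
    have hvar := h.variance_nonneg i hr.1 hr.2
    have hvar' := degreeVariance_le (W i) d p.1
    have hT : 0 ≤ thetaCut ρ δ p.1 := (abs_nonneg _).trans hθ
    rw [norm_neg]
    refine (norm_sub_le _ _).trans ?_
    simp only [Function.comp, pow_one, norm_mul, norm_div, norm_pow, Complex.norm_I,
      Complex.norm_real, Real.norm_eq_abs, one_mul, abs_of_nonneg hmean, abs_of_nonneg hvar]
    refine add_le_add ?_ ?_
    · exact mul_le_mul_of_nonneg_right hθ hmean
    · have h2 : |p.2| ^ 2 / ‖(2 : ℂ)‖ ≤ thetaCut ρ δ p.1 ^ 2 := by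
        have : |p.2| ^ 2 ≤ thetaCut ρ δ p.1 ^ 2 := by gcongr
        have h3 : ‖(2 : ℂ)‖ = 2 := by simp
        rw [h3]
        linarith [sq_nonneg |p.2|]
      exact mul_le_mul h2 hvar' hvar (by positivity)
  have hfinal := hE.cexp.mul (tendsto_finsetProd Finset.univ fun i _ => (hW i).mul (hG i).cexp)
  simp only [Complex.exp_zero, mul_one, Finset.prod_const_one] at hfinal
  refine hfinal.congr' ?_
  filter_upwards [hmemr] with p hr
  exact (h.div_gaussian_eq hr.1 hr.2 p.2).symm

/-- For |θ| ≥ χ^(1+δ) and χ ≤ 1 the minimum in the gap is at least χ^(2δ), so |F| drops by exp(-a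
χ^(-(β-2δ))), which is smaller than any power of χ and hence than b^(-1/2). -/
theorem decay (h : IsExpMulProd F w W d ρ) {q : ℝ}
    (hB : ∀ᶠ r in 𝓝[<] ρ, haymanB F r ≤ Real.log (ρ / r) ^ (-q))
    (hmain : Tendsto (degreeMoment w d 0) (𝓝[<] ρ) atTop)
    (hgap : HasCosineGap w d ρ β) (hδ0 : 0 < δ) (hδβ : 2 * δ < β) {η : ℝ} (hη : 0 < η) :
    ∀ᶠ r : ℝ in 𝓝[<] ρ, ∀ θ : ℝ, thetaCut ρ δ r ≤ |θ| → |θ| < Real.pi →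
      ‖F ((r : ℂ) * Complex.exp (Complex.I * (θ : ℂ)))‖
        ≤ η * ((haymanB F r) ^ (-(1 / 2) : ℝ) * ‖F (r : ℂ)‖) := by
  obtain ⟨a, χ₀, ha, hχ₀, H⟩ := hgap
  have hlog := tendsto_log_div_nhdsLT h.radius_pos
  have hsmall := (((tendsto_rpow_mul_exp_neg_mul_rpow_nhdsGT_zero (-(q / 2)) ha
    (show 0 < β - 2 * δ by linarith)).comp hlog).eventually (gt_mem_nhds hη))
  filter_upwards [Ioo_mem_nhdsLT h.radius_pos, hB, hsmall, hmain.eventually_ge_atTop 1,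
    hlog.eventually (Ioo_mem_nhdsGT (lt_min hχ₀ one_pos))] with r hr hBr hsm hm hχ θ hθ hθπ
  have hχ0 := hχ.1
  have hχ1 := hχ.2.le.trans (min_le_right _ _)
  have hgapr := H r hr.1 hr.2 (hχ.2.le.trans (min_le_left _ _)) θ hθπ.le
  have hBpos : 0 < haymanB F r := by linarith [h.moment_zero_le_haymanB hr.1 hr.2]
  simp only [Function.comp] at hsm
  rw [thetaCut] at hθ
  set χ := Real.log (ρ / r) with hχdef
  refine (h.norm_le_exp_mul hr.1 hr.2 θ).trans ?_
  rw [← mul_assoc]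
  refine mul_le_mul_of_nonneg_right ?_ (norm_nonneg _)
  have hmin : χ ^ (2 * δ) ≤ min 1 ((θ / χ) ^ 2) := by
    refine le_min (Real.rpow_le_one hχ0.le hχ1 (by linarith)) ?_
    rw [div_pow, le_div_iff₀ (by positivity), ← sq_abs θ]
    calc χ ^ (2 * δ) * χ ^ 2 = (χ ^ (1 + δ)) ^ 2 := by
          rw [← Real.rpow_natCast χ, ← Real.rpow_add hχ0, ← Real.rpow_natCast (χ ^ (1 + δ)),
            ← Real.rpow_mul hχ0.le]
          congr 1
          push_cast
          ring
      _ ≤ |θ| ^ 2 := by gcongr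
  have hdrop : a * χ ^ (-(β - 2 * δ)) ≤ degreeMoment w d 0 r
      - (degreeSeries w d ((r : ℂ) * Complex.exp (Complex.I * (θ : ℂ)))).re := by
    refine le_trans ?_ hgapr
    rw [show -(β - 2 * δ) = -β + 2 * δ by ring, Real.rpow_add hχ0, ← mul_assoc]
    gcongr
  have hBinv : χ ^ (q / 2) ≤ haymanB F r ^ (-(1 / 2) : ℝ) := by
    calc χ ^ (q / 2) = (χ ^ (-q)) ^ (-(1 / 2) : ℝ) := by
          rw [← Real.rpow_mul hχ0.le]
          congr 1
          ring
      _ ≤ _ := Real.rpow_le_rpow_of_nonpos hBpos hBr (by norm_num)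
  calc Real.exp (-(degreeMoment w d 0 r
        - (degreeSeries w d ((r : ℂ) * Complex.exp (Complex.I * (θ : ℂ)))).re))
      ≤ Real.exp (-a * χ ^ (-(β - 2 * δ))) := Real.exp_le_exp.2 (by linarith)
    _ = χ ^ (q / 2) * (χ ^ (-(q / 2)) * Real.exp (-a * χ ^ (-(β - 2 * δ)))) := by
        rw [← mul_assoc, ← Real.rpow_add hχ0, add_neg_cancel, Real.rpow_zero, one_mul]
    _ ≤ χ ^ (q / 2) * η := by gcongr
    _ ≤ η * haymanB F r ^ (-(1 / 2) : ℝ) := by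
        rw [mul_comm]
        gcongr

/-- The gap for the factors is needed only to make their masses tend to infinity: this controls the
normalised moments and makes F blow up at ρ, which fixes the radius. -/
theorem isHAdmissibleWith (h : IsExpMulProd F w W d ρ) (hα : 0 < α) {B : ℝ}
    (hthird : ∀ r : ℝ, 0 < r → r < ρ → degreeMoment w d 3 r ≤ B * Real.log (ρ / r) ^ (-α - 3))
    (hgap : HasCosineGap w d ρ β) (hgapW : ∀ i, HasCosineGap (W i) d ρ β)
    (hpolyW : ∀ i, HasPolynomialMoments (W i) d ρ) (hδ : α / 3 < δ) (hδβ : 2 * δ < β) :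
    IsHAdmissibleWith F ρ (thetaCut ρ δ) := by
  have hδ0 : 0 < δ := by linarith
  have hβ : 0 < β := by linarith
  have hρ := h.radius_pos
  have hmain := hgap.tendsto_moment_zero h.main hρ hβ
  have hratio := fun i (k : ℕ) (hk : k ≠ 0) => tendsto_thetaCut_pow_mul_moment_div (h.factor i) hρ
    hβ (hgapW i) (hpolyW i) hδ0 hk
  obtain ⟨P, hP⟩ := exists_hasFPowerSeriesOnBall_of_differentiableOn_ball hρ h.differentiableOn
  refine ⟨hρ, ⟨P, radius_eq_of_tendsto_norm_atTop hρ hP (h.tendsto_norm_atTop hmain fun i =>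
    (hgapW i).tendsto_moment_zero (h.factor i) hρ hβ), hP⟩, ⟨0, le_rfl, hρ, fun r hr hrρ => ?_⟩,
    h.tendsto_haymanA hmain, h.tendsto_haymanB hmain, fun η hη => ?_, fun η hη => ?_⟩
  · rw [h.apply_ofReal hr hrρ]
    exact ⟨Complex.ofReal_im _, mul_pos (Real.exp_pos _) (h.prod_pos hr hrρ),
      Real.rpow_pos_of_pos (log_div_pos hr hrρ) _⟩
  · have h1 := (h.tendsto_div_gaussian hthird hδ hratio).eventually (Metric.closedBall_mem_nhds 1 hη)
    rw [eventually_inf_principal, eventually_comap] at h1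
    filter_upwards [h1] with r hr θ hθ
    have h2 := hr (r, θ) rfl hθ
    rwa [dist_eq_norm] at h2
  · obtain ⟨q, hq⟩ := h.exists_haymanB_le hthird hα hδ0 fun i => hratio i 2 two_ne_zero
    exact h.decay hq hmain hgap hδ0 hδβ hη

end IsExpMulProd

/-! ### Specialisation to S and G. -/

theorem isHAdmissibleWith_of_clusterSeries {α β ρ δ : ℝ} (hα : 0 < α) (hρ : 0 < ρ) (hρ1 : ρ ≤ 1)
    {c : ℕ → ℝ} (hc : c ∈ oscillatingExpansive β α ρ) (hδ : α / 3 < δ) (hδβ : 2 * δ < β)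
    {κ : Type*} [Fintype κ] {v : ℕ → ℝ} {u : κ → ℕ → ℝ} {q : κ → ℝ}
    (hv0 : ∀ j, 0 ≤ v j) (hv1 : v 0 = 1) (hv : ∀ j : ℕ, v j ≤ ((j : ℝ) + 1) ^ (-1 : ℝ))
    (hu0 : ∀ i j, 0 ≤ u i j) (hu1 : ∀ i, u i 0 = 1)
    (hu : ∀ i (j : ℕ), u i j ≤ ((j : ℝ) + 1) ^ q i) {F : ℂ → ℂ}
    (hF : ∀ x, F x = Complex.exp (∑' j : ℕ, (v j : ℂ) * clusterSeries c (x ^ (j + 1)))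
      * ∏ i, ∑' j : ℕ, (u i j : ℂ) * clusterSeries c (x ^ (j + 1))) :
    IsHAdmissibleWith F ρ (thetaCut ρ δ) := by
  have hβ : 0 < β := by linarith
  obtain ⟨K, hK, hcK⟩ := exists_forall_le_of_oscillatingExpansive hρ hc
  obtain ⟨hc0, A₁, A₂, hA₁, -, hA⟩ := hc
  have hcA := hA.mono fun n hn => hn.1
  have hD := isDegreeSeries_cluster hρ hρ1 hc0 hK hcK hv0 hv
  have hW := fun i => isDegreeSeries_cluster hρ hρ1 hc0 hK hcK (hu0 i) (hu i)
  obtain ⟨n, hn, hn1⟩ := (hcA.and (eventually_ge_atTop 1)).exists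
  have hcn : 0 < c n := by
    refine lt_of_lt_of_le ?_ hn
    have : (0 : ℝ) < n := by exact_mod_cast hn1
    positivity
  have hprod : IsExpMulProd F (clusterWeight c v) (fun i => clusterWeight c (u i)) clusterDegree
      ρ := by
    refine ⟨hρ, hD, hW, fun i r hr hrρ => (hW i).moment_pos (i := (0, n - 1)) ?_ 0 hr hrρ,
      fun x hx => ?_⟩
    · rw [clusterWeight, hu1, one_mul, Nat.sub_add_cancel hn1]
      exact hcn
    · rw [hF, tsum_mul_clusterSeries hD hx]
      congr 1
      exact Finset.prod_congr rfl fun i _ => tsum_mul_clusterSeries (hW i) hx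
  -- The sharp choice s = α + 2 gives D_3 = O(χ^(-α-3)). With v_j ≤ (j+1)^(-1) the convergence
  -- condition reads 2 < α + 2, that is α > 0.
  obtain ⟨B, -, hB⟩ := exists_clusterMoment_le hρ hρ1 hc0 hK hcK hv0 hv 3 (s := α + 2)
    (by linarith) (by push_cast; linarith) (by push_cast; linarith)
  refine hprod.isHAdmissibleWith hα (B := B) (fun r hr hrρ => ?_)
    (exists_le_clusterMoment_sub_re hA₁ hβ hρ hcA hD hv1)
    (fun i => exists_le_clusterMoment_sub_re hA₁ hβ hρ hcA (hW i) (hu1 i)) (fun i k => ?_) hδ hδβ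
  · rw [show -α - 3 = -(α + 2) - 1 by ring]
    exact (hB r hr hrρ).2
  · obtain ⟨B', M, hB', H⟩ := exists_clusterMoment_le_rpow hρ hρ1 hc0 hK hcK (hu0 i) (hu i) k
    exact ⟨B', M, hB', fun r hr hrρ => (H r hr hrρ).2⟩

theorem clusterSeries_eq_tsum_ite (c : ℕ → ℝ) (x : ℂ) :
    clusterSeries c x
      = ∑' j : ℕ, ((if j = 0 then 1 else 0 : ℝ) : ℂ) * clusterSeries c (x ^ (j + 1)) := by
  rw [tsum_eq_single 0 fun j hj => by simp [hj]]
  simp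

theorem ite_le_rpow (q : ℝ) (j : ℕ) : (if j = 0 then 1 else 0 : ℝ) ≤ ((j : ℝ) + 1) ^ q := by
  split_ifs with h
  · simp [h]
  · positivity

theorem mainTheorem2 (α ε ρ : ℝ) (hα : 0 < α) (hρ : 0 < ρ) (hρ1 : ρ ≤ 1)
    (hε : 0 < ε) (hεα : ε < α / 3) (c : ℕ → ℝ)
    (hc : c ∈ oscillatingExpansive (2 * α / 3 + ε) α ρ) (ℓ : ℕ) (p : Fin ℓ → ℕ) :
    IsHAdmissible (fun x : ℂ => setSeries c x * clusterSeries c x ^ ℓ) ρ ∧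
    IsHAdmissible
      (fun x : ℂ => multisetSeries c x * ∏ i : Fin ℓ, weightedClusterSeries c (p i) x) ρ ∧
    ∀ δ : ℝ, α / 3 < δ → δ < α / 3 + ε / 2 →
      IsHAdmissibleWith (fun x : ℂ => setSeries c x * clusterSeries c x ^ ℓ) ρ
        (thetaCut ρ δ) ∧
      IsHAdmissibleWith
        (fun x : ℂ => multisetSeries c x * ∏ i : Fin ℓ, weightedClusterSeries c (p i) x) ρ
        (thetaCut ρ δ) := by
  have key : ∀ δ : ℝ, α / 3 < δ → δ < α / 3 + ε / 2 →
      IsHAdmissibleWith (fun x : ℂ => setSeries c x * clusterSeries c x ^ ℓ) ρ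
        (thetaCut ρ δ) ∧
      IsHAdmissibleWith
        (fun x : ℂ => multisetSeries c x * ∏ i : Fin ℓ, weightedClusterSeries c (p i) x) ρ
        (thetaCut ρ δ) := by
    intro δ hδ hδε
    have hδβ : 2 * δ < 2 * α / 3 + ε := by linarith
    constructor
    · refine isHAdmissibleWith_of_clusterSeries hα hρ hρ1 hc hδ hδβ (κ := Fin ℓ)
        (v := fun j => if j = 0 then 1 else 0) (u := fun _ j => if j = 0 then 1 else 0)
        (q := fun _ => 0) (fun j => by positivity) (by simp) (ite_le_rpow _)
        (fun _ j => by positivity) (by simp) (fun _ => ite_le_rpow _) fun x => ?_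
      rw [setSeries, ← clusterSeries_eq_tsum_ite, Finset.prod_const, Finset.card_univ,
        Fintype.card_fin]
    · refine isHAdmissibleWith_of_clusterSeries hα hρ hρ1 hc hδ hδβ (κ := Fin ℓ)
        (v := fun j => ((j : ℝ) + 1)⁻¹) (u := fun i j => ((j : ℝ) + 1) ^ p i)
        (q := fun i => p i) (fun j => by positivity) (by simp)
        (fun j => (Real.rpow_neg_one _).ge) (fun _ j => by positivity) (by simp)
        (fun i j => (Real.rpow_natCast _ _).ge) fun x => ?_
      simp only [multisetSeries, weightedClusterSeries]
      push_cast
      simp only [div_eq_inv_mul]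
  -- The midpoint of the admissible window for δ.
  have hmid := key (α / 3 + ε / 4) (by linarith) (by linarith)
  exact ⟨⟨_, hmid.1⟩, ⟨_, hmid.2⟩, key⟩
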